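/- Let $A$ be a $C^*$-algebra and let $E$ be a $C^*$-correspondence over $A$: a right Hilbert $A$-module with inner product $\langle\cdot,\cdot\rangle_A$ (linear in the second variable), together with a $*$-homomorphism $\Phi$ from $A$ to the bounded adjointable operators on $E$. It is not assumed that $A$ is unital, that $E$ is full, or that $\Phi$ is injective or nondegenerate. For $\xi,\eta\in E$ let $\theta_{\xi,\eta}\zeta=\xi\cdot\langle\eta,\zeta\rangle_A$, let $\mathcal K(E)$ be the closed linear span of the operators $\theta_{\xi,\eta}$, and let $\Lambda\subset E$ be a subset such that the net $\{\sum_{\xi\in F}\theta_{\xi,\xi}\}_F$, indexed by the finite subsets $F$ of $\Lambda$ ordered by inclusion, is an approximate unit of $\mathcal K(E)$. Every sum $\sum_{\xi\in\Lambda}$ below is the limit of the partial sums over this directed set, and its convergence is part of the assertion. Let $\mathcal T_E$ be the Cuntz--Toeplitz algebra of $E$, that is, the universal $C^*$-algebra generated by symbols $\Pi(a)$ ($a\in A$) and $T_\xi$ ($\xi\in E$) such that $\Pi$ is a $*$-homomorphism, $\Pi(a)T_\xi=T_{\Phi(a)\xi}$ and $T_\xi^*T_\eta=\Pi(\langle\xi,\eta\rangle_A)$.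 Let $\gamma$ be the gauge action of $\mathbb R$ on $\mathcal T_E$, given by $\gamma_t(\Pi(a))=\Pi(a)$ and $\gamma_t(T_\xi)=e^{it}T_\xi$. Let $\beta$ be a nonzero real number. A $\beta$-KMS state of $\gamma$ is a state $\omega$ of $\mathcal T_E$ with $\omega(x\,\gamma_{i\beta}(y))=\omega(yx)$ for all $x\in\mathcal T_E$ and all $\gamma$-entire $y\in\mathcal T_E$; it is of infinite type if $\sum_{\xi\in\Lambda}\omega(T_\xi T_\xi^*)=1$. Let $K_\beta^\infty(\gamma)$ be the set of $\beta$-KMS states of $\gamma$ of infinite type. Let $S_\beta$ be the set of finite traces $\tau$ of $A$ (everywhere defined positive linear functionals with $\tau(ab)=\tau(ba)$) such that $$e^{-\beta}\sum_{\xi\in\Lambda}\tau(\langle\xi,\xi\rangle_A)=1\qquad\text{and}\qquad e^{-\beta}\sum_{\xi\in\Lambda}\tau(\langle\xi,\Phi(a)\xi\rangle_A)=\tau(a)\quad\text{for all }a\in A.$$ Then $K_\beta^\infty(\gamma)$ and $S_\beta$ are convex, and the restriction map $\omega\mapsto\tau=\omega\circ\Pi$ is an affine isomorphism (an affine bijection)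 of $K_\beta^\infty(\gamma)$ onto $S_\beta$. If moreover $\Phi$ is nondegenerate (the linear span of $\Phi(A)E$ is dense in $E$), then every $\tau\in S_\beta$ is a trace state, that is, $\|\tau\|=1$. -/

import Mathlib

open scoped ComplexOrder

namespace CuntzToeplitz

noncomputable section

/-! ### Right Hilbert modules and `C*`-correspondences

Mathlib's `CStarModule B E` has `⟪x, b • y⟫ = b * ⟪x, y⟫`, so it is a Hilbert module on which `B` acts
from the left. A right Hilbert `A`-module is the same thing as a `CStarModule Aᵐᵒᵖ E`, with
`ξ · a = op a • ξ` and `⟨ξ, η⟩_A = unop ⟪ξ, η⟫`; the lemmas `ip_rsmul` and so on record the usual rules. -/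

theorem le_of_sq_le {a b : ℝ} (h : a ^ 2 ≤ b ^ 2) (hb : 0 ≤ b) : a ≤ b := abs_le_of_sq_le_sq' h hb |>.2

section Module

variable {A E : Type*} [NonUnitalCStarAlgebra A] [PartialOrder A] [StarOrderedRing A]
  [NormedAddCommGroup E] [NormedSpace ℂ E] [SMul Aᵐᵒᵖ E] [CStarModule Aᵐᵒᵖ E]

/-- The `A`-valued inner product of a right Hilbert `A`-module, linear in the second variable. -/
def ip (A : Type*) {E : Type*} [NonUnitalCStarAlgebra A] [PartialOrder A] [StarOrderedRing A]
    [NormedAddCommGroup E] [NormedSpace ℂ E] [SMul Aᵐᵒᵖ E] [CStarModule Aᵐᵒᵖ E] (ξ η : E) : A :=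
  MulOpposite.unop (inner Aᵐᵒᵖ ξ η)

/-- The right action `ξ · a`. -/
def rsmul (ξ : E) (a : A) : E := MulOpposite.op a • ξ

theorem ip_add_right (ξ η ζ : E) : ip A ξ (η + ζ) = ip A ξ η + ip A ξ ζ := by
  simp [ip]

theorem ip_smul_right (ξ η : E) (c : ℂ) : ip A ξ (c • η) = c • ip A ξ η := by
  simp [ip]

theorem star_ip (ξ η : E) : star (ip A ξ η) = ip A η ξ := by
  rw [ip, ← MulOpposite.unop_star, CStarModule.star_inner]; rfl

theorem ip_rsmul (ξ η : E) (a : A) : ip A ξ (rsmul η a) = ip A ξ η * a := by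
  simp [ip, rsmul]

theorem ip_self_nonneg (ξ : E) : 0 ≤ ip A ξ ξ :=
  (CStarModule.inner_self_nonneg (A := Aᵐᵒᵖ) (x := ξ))

theorem norm_sq_eq_norm_ip (ξ : E) : ‖ξ‖ ^ 2 = ‖ip A ξ ξ‖ :=
  CStarModule.norm_sq_eq Aᵐᵒᵖ

theorem norm_ip_le (ξ η : E) : ‖ip A ξ η‖ ≤ ‖ξ‖ * ‖η‖ :=
  CStarModule.norm_inner_le (A := Aᵐᵒᵖ) E

theorem ext_ip {η ζ : E} (h : ∀ ξ : E, ip A ξ η = ip A ξ ζ) : η = ζ := by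
  rw [← sub_eq_zero, ← CStarModule.inner_self (A := Aᵐᵒᵖ), CStarModule.inner_sub_right, sub_eq_zero]
  exact MulOpposite.unop_injective (h _)

theorem rsmul_add (ξ : E) (a b : A) : rsmul ξ (a + b) = rsmul ξ a + rsmul ξ b :=
  ext_ip (A := A) fun ζ => by simp only [ip_add_right, ip_rsmul, mul_add]

theorem rsmul_smul (ξ : E) (c : ℂ) (a : A) : rsmul ξ (c • a) = c • rsmul ξ a :=
  ext_ip (A := A) fun ζ => by simp only [ip_smul_right, ip_rsmul, mul_smul_comm]

theorem norm_rsmul_le (ξ : E) (a : A) : ‖rsmul ξ a‖ ≤ ‖ξ‖ * ‖a‖ := by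
  refine le_of_sq_le ?_ (by positivity)
  rw [norm_sq_eq_norm_ip (A := A), ip_rsmul, ← star_ip, ip_rsmul, star_mul, star_ip, mul_pow,
    norm_sq_eq_norm_ip (A := A)]
  calc ‖star a * ip A ξ ξ * a‖ ≤ ‖star a‖ * ‖ip A ξ ξ‖ * ‖a‖ :=
        (norm_mul_le _ _).trans (by gcongr; exact norm_mul_le _ _)
    _ = ‖ip A ξ ξ‖ * ‖a‖ ^ 2 := by rw [norm_star]; ring

/-- The rank one operator `θ_{ξ,η} ζ = ξ · ⟨η, ζ⟩_A`. -/
def theta (A : Type*) {E : Type*} [NonUnitalCStarAlgebra A] [PartialOrder A] [StarOrderedRing A]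
    [NormedAddCommGroup E] [NormedSpace ℂ E] [SMul Aᵐᵒᵖ E] [CStarModule Aᵐᵒᵖ E]
    (ξ η : E) : E →L[ℂ] E :=
  LinearMap.mkContinuous
    { toFun := fun ζ => rsmul ξ (ip A η ζ)
      map_add' := fun ζ ζ' => by rw [ip_add_right, rsmul_add]
      map_smul' := fun c ζ => by rw [ip_smul_right, rsmul_smul]; rfl }
    (‖ξ‖ * ‖η‖) fun ζ => (norm_rsmul_le _ _).trans (by
      rw [mul_assoc]; exact mul_le_mul_of_nonneg_left (norm_ip_le _ _) (norm_nonneg _))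

/-- `𝒦(E)`: the closed linear span of the rank one operators (for the operator norm). -/
def compacts (A E : Type*) [NonUnitalCStarAlgebra A] [PartialOrder A] [StarOrderedRing A]
    [NormedAddCommGroup E] [NormedSpace ℂ E] [SMul Aᵐᵒᵖ E] [CStarModule Aᵐᵒᵖ E] :
    Submodule ℂ (E →L[ℂ] E) :=
  (Submodule.span ℂ {k | ∃ ξ η : E, k = theta A ξ η}).topologicalClosure

/-- The net `∑_{ξ ∈ F} θ_{ξ,ξ}`, indexed by the finite subsets `F` of `Λ`, is an approximate unit
of `𝒦(E)`. (The net is increasing and positive by its form, and the two limits force it to be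
contractive.) -/
def IsFrame (A : Type*) {E : Type*} [NonUnitalCStarAlgebra A] [PartialOrder A] [StarOrderedRing A]
    [NormedAddCommGroup E] [NormedSpace ℂ E] [SMul Aᵐᵒᵖ E] [CStarModule Aᵐᵒᵖ E]
    (Λ : Set E) : Prop :=
  ∀ k ∈ compacts A E,
    Filter.Tendsto (fun F : Finset Λ => (∑ ξ ∈ F, theta A (ξ : E) (ξ : E)) * k)
      Filter.atTop (nhds k) ∧
    Filter.Tendsto (fun F : Finset Λ => k * (∑ ξ ∈ F, theta A (ξ : E) (ξ : E)))
      Filter.atTop (nhds k)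

end Module

/-- The structure that makes a right Hilbert `A`-module a `C*`-correspondence over `A`: a
`*`-homomorphism `Φ` from `A` to the bounded adjointable operators on `E`, the adjoint of `Φ a` being
`Φ (star a)`. -/
structure Correspondence (A E : Type*) [NonUnitalCStarAlgebra A] [PartialOrder A]
    [StarOrderedRing A] [NormedAddCommGroup E] [NormedSpace ℂ E] [SMul Aᵐᵒᵖ E]
    [CStarModule Aᵐᵒᵖ E] where
  Φ : A →ₙₐ[ℂ] (E →L[ℂ] E)
  adjoint : ∀ (a : A) (ξ η : E), ip A (Φ a ξ) η = ip A ξ (Φ (star a) η)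

section Toeplitz

variable {A E : Type*} [NonUnitalCStarAlgebra A] [PartialOrder A] [StarOrderedRing A]
  [NormedAddCommGroup E] [NormedSpace ℂ E] [SMul Aᵐᵒᵖ E] [CStarModule Aᵐᵒᵖ E]

/-- `Φ` is nondegenerate: `Φ(A) E` spans a dense subspace of `E`. -/
def Correspondence.Nondegenerate (X : Correspondence A E) : Prop :=
  (Submodule.span ℂ {ζ | ∃ (a : A) (ξ : E), ζ = X.Φ a ξ}).topologicalClosure = ⊤

/-! ### The free `*`-algebra -/

/-- The symbols `Π(a)`, `T_ξ`, `T_ξ^*`. -/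
inductive Gen (A E : Type*)
  | pi (a : A)
  | t (ξ : E)
  | tAdj (ξ : E)

set_option linter.unusedSectionVars false

/-- The adjoint of a symbol. -/
def Gen.adj : Gen A E → Gen A E
  | pi a => pi (star a)
  | t ξ => tAdj ξ
  | tAdj ξ => t ξ

theorem Gen.adj_adj (g : Gen A E) : g.adj.adj = g := by
  cases g <;> simp [Gen.adj]

/-- The free unital complex algebra on the symbols. -/
@[nolint unusedArguments]
def Free (_X : Correspondence A E) := FreeAlgebra ℂ (Gen A E)

variable (X : Correspondence A E)

instance : Ring (Free X) := inferInstanceAs (Ring (FreeAlgebra ℂ (Gen A E)))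
instance : Algebra ℂ (Free X) := inferInstanceAs (Algebra ℂ (FreeAlgebra ℂ (Gen A E)))

/-- A symbol as an element of the free algebra. -/
def gen (g : Gen A E) : Free X := FreeAlgebra.ι ℂ g

/-- The conjugate linear antimultiplicative map of the free algebra that acts on the symbols as
`Gen.adj`. -/
def starHom : Free X →+* (Free X)ᵐᵒᵖ :=
  letI : Algebra ℂ (Free X)ᵐᵒᵖ := Algebra.compHom _ (starRingEnd ℂ)
  (FreeAlgebra.lift ℂ (A := (Free X)ᵐᵒᵖ)
    (fun g : Gen A E => MulOpposite.op (gen X g.adj))).toRingHom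

theorem starHom_algebraMap (c : ℂ) :
    starHom X (algebraMap ℂ (Free X) c) = MulOpposite.op (algebraMap ℂ (Free X) (star c)) := by
  let : Algebra ℂ (Free X)ᵐᵒᵖ := Algebra.compHom _ (starRingEnd ℂ)
  exact AlgHom.commutes (FreeAlgebra.lift ℂ (A := (Free X)ᵐᵒᵖ)
    (fun g : Gen A E => MulOpposite.op (gen X g.adj))) c

theorem starHom_gen (g : Gen A E) : starHom X (gen X g) = MulOpposite.op (gen X g.adj) := by
  let : Algebra ℂ (Free X)ᵐᵒᵖ := Algebra.compHom _ (starRingEnd ℂ)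
  exact FreeAlgebra.lift_ι_apply (A := (Free X)ᵐᵒᵖ)
    (fun g : Gen A E => MulOpposite.op (gen X g.adj)) g

theorem free_induction {P : Free X → Prop} (h0 : ∀ c, P (algebraMap ℂ (Free X) c))
    (h1 : ∀ g, P (gen X g)) (hm : ∀ a b, P a → P b → P (a * b))
    (ha : ∀ a b, P a → P b → P (a + b)) (a : Free X) : P a :=
  FreeAlgebra.induction ℂ (Gen A E) h0 h1 hm ha a

instance : StarRing (Free X) where
  star x := (starHom X x).unop
  star_involutive x := by
    change (starHom X (starHom X x).unop).unop = x
    induction x using free_induction with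
    | h0 c => simp [starHom_algebraMap]
    | h1 g => simp [starHom_gen, Gen.adj_adj]
    | hm a b ha hb => simp [ha, hb]
    | ha a b ha hb => simp [ha, hb]
  star_mul a b := by simp [map_mul]
  star_add a b := by simp [map_add]

theorem star_algebraMap_free (c : ℂ) :
    star (algebraMap ℂ (Free X) c) = algebraMap ℂ (Free X) (star c) := by
  change (starHom X _).unop = _
  rw [starHom_algebraMap]; rfl

theorem star_gen (g : Gen A E) : star (gen X g) = gen X g.adj := by
  change (starHom X _).unop = _
  rw [starHom_gen]; rfl

instance : StarModule ℂ (Free X) where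
  star_smul c x := by
    rw [Algebra.smul_def, star_mul, star_algebraMap_free, Algebra.smul_def, Algebra.commutes]

/-! ### The universal `C*`-seminorm -/

/-- The `C*`-seminorms on the free `*`-algebra that come from representations of the
correspondence: those that vanish on the defining relations. (The bound in `pi_le` holds for every
representation of a `C*`-algebra; it is recorded to make the supremum below visibly finite.) -/
structure ToeplitzSeminorm extends RingSeminorm (Free X) where
  smul_eq : ∀ (c : ℂ) (x : Free X), toFun (c • x) = ‖c‖ * toFun x
  cstar : ∀ x : Free X, toFun (star x * x) = toFun x ^ 2
  pi_le : ∀ a : A, toFun (gen X (.pi a)) ≤ ‖a‖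
  pi_add : ∀ a b : A, toFun (gen X (.pi (a + b)) - (gen X (.pi a) + gen X (.pi b))) = 0
  pi_smul : ∀ (c : ℂ) (a : A), toFun (gen X (.pi (c • a)) - c • gen X (.pi a)) = 0
  pi_mul : ∀ a b : A, toFun (gen X (.pi (a * b)) - gen X (.pi a) * gen X (.pi b)) = 0
  pi_t : ∀ (a : A) (ξ : E), toFun (gen X (.pi a) * gen X (.t ξ) - gen X (.t (X.Φ a ξ))) = 0
  t_t : ∀ ξ η : E, toFun (star (gen X (.t ξ)) * gen X (.t η) - gen X (.pi (ip A ξ η))) = 0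

variable {X}

theorem ToeplitzSeminorm.nonneg (p : ToeplitzSeminorm X) (x : Free X) : 0 ≤ p.toFun x :=
  apply_nonneg p.toRingSeminorm x

theorem ToeplitzSeminorm.star_le (p : ToeplitzSeminorm X) (x : Free X) :
    p.toFun x ≤ p.toFun (star x) := by
  have h := p.mul_le' (star x) x
  rw [p.cstar, pow_two] at h
  by_contra hlt
  push Not at hlt
  have h0 := p.nonneg (star x)
  nlinarith

theorem ToeplitzSeminorm.star_eq (p : ToeplitzSeminorm X) (x : Free X) :
    p.toFun (star x) = p.toFun x :=
  le_antisymm (by simpa using p.star_le (star x)) (p.star_le x)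

instance : Nonempty (ToeplitzSeminorm X) :=
  ⟨{ toFun := fun _ => 0
     map_zero' := rfl
     add_le' := by simp
     neg' := by simp
     mul_le' := by simp
     smul_eq := by simp
     cstar := by simp
     pi_le := by simp
     pi_add := by simp
     pi_smul := by simp
     pi_mul := by simp
     pi_t := by simp
     t_t := by simp }⟩

theorem ToeplitzSeminorm.t_le (p : ToeplitzSeminorm X) (ξ : E) :
    p.toFun (gen X (.t ξ)) ≤ ‖ξ‖ := by
  refine le_of_sq_le ?_ (norm_nonneg ξ)
  rw [← p.cstar, norm_sq_eq_norm_ip (A := A)]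
  have h := p.add_le' (star (gen X (.t ξ)) * gen X (.t ξ) - gen X (.pi (ip A ξ ξ)))
    (gen X (.pi (ip A ξ ξ)))
  have h2 := p.t_t ξ ξ
  have h3 := p.pi_le (ip A ξ ξ)
  rw [sub_add_cancel] at h
  change p.toFun _ ≤ p.toFun _ + p.toFun _ at h
  linarith

theorem bddAbove_seminorm (x : Free X) :
    BddAbove (Set.range fun p : ToeplitzSeminorm X => p.toFun x) := by
  suffices h : ∃ C, ∀ p : ToeplitzSeminorm X, p.toFun x ≤ C by
    obtain ⟨C, hC⟩ := h
    exact ⟨C, by rintro _ ⟨p, rfl⟩; exact hC p⟩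
  induction x using free_induction with
  | h0 c =>
    refine ⟨‖c‖, fun p => ?_⟩
    have h1 : p.toFun 1 ≤ 1 := by
      have h := p.cstar 1
      rw [star_one, one_mul] at h
      have := p.nonneg 1
      nlinarith
    rw [Algebra.algebraMap_eq_smul_one, p.smul_eq]
    nlinarith [norm_nonneg c]
  | h1 g =>
    cases g with
    | pi a => exact ⟨‖a‖, fun p => p.pi_le a⟩
    | t ξ => exact ⟨‖ξ‖, fun p => p.t_le ξ⟩
    | tAdj ξ =>
      refine ⟨‖ξ‖, fun p => ?_⟩
      have : gen X (.tAdj ξ) = star (gen X (.t ξ)) := by rw [star_gen]; rfl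
      rw [this, p.star_eq]
      exact p.t_le ξ
  | hm a b ha hb =>
    obtain ⟨C, hC⟩ := ha
    obtain ⟨D, hD⟩ := hb
    exact ⟨C * D, fun p => (p.mul_le' a b).trans
      (mul_le_mul (hC p) (hD p) (p.nonneg b) ((p.nonneg a).trans (hC p)))⟩
  | ha a b ha hb =>
    obtain ⟨C, hC⟩ := ha
    obtain ⟨D, hD⟩ := hb
    exact ⟨C + D, fun p => (p.add_le' a b).trans (add_le_add (hC p) (hD p))⟩

variable (X)

/-- The universal `C*`-seminorm: the supremum of all the seminorms that come from
representations. -/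
def univSeminorm : RingSeminorm (Free X) where
  toFun x := ⨆ p : ToeplitzSeminorm X, p.toFun x
  map_zero' := by
    have h : ∀ p : ToeplitzSeminorm X, p.toFun 0 = 0 := fun p => p.map_zero'
    simp [h]
  add_le' x y := ciSup_le fun p => (p.add_le' x y).trans
    (add_le_add (le_ciSup (bddAbove_seminorm x) p) (le_ciSup (bddAbove_seminorm y) p))
  neg' x := by
    have h : ∀ p : ToeplitzSeminorm X, p.toFun (-x) = p.toFun x := fun p => p.neg' x
    simp [h]
  mul_le' x y := ciSup_le fun p => (p.mul_le' x y).trans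
    (mul_le_mul (le_ciSup (bddAbove_seminorm x) p) (le_ciSup (bddAbove_seminorm y) p)
      (p.nonneg y) ((p.nonneg x).trans (le_ciSup (bddAbove_seminorm x) p)))

instance : SeminormedRing (Free X) := (univSeminorm X).toSeminormedRing

theorem free_norm_def (x : Free X) : ‖x‖ = ⨆ p : ToeplitzSeminorm X, p.toFun x := rfl

variable {X} in
theorem ToeplitzSeminorm.le_norm (p : ToeplitzSeminorm X) (x : Free X) : p.toFun x ≤ ‖x‖ :=
  le_ciSup (bddAbove_seminorm x) p

variable {X} in
theorem free_norm_le {x : Free X} {C : ℝ} (h : ∀ p : ToeplitzSeminorm X, p.toFun x ≤ C) :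
    ‖x‖ ≤ C := ciSup_le h

variable {X} in
theorem free_norm_eq_zero {x : Free X} (h : ∀ p : ToeplitzSeminorm X, p.toFun x = 0) :
    ‖x‖ = 0 := le_antisymm (free_norm_le fun p => (h p).le) (norm_nonneg _)

instance : NormedAlgebra ℂ (Free X) where
  norm_smul_le c x := free_norm_le fun p => by
    rw [p.smul_eq]
    exact mul_le_mul_of_nonneg_left (p.le_norm x) (norm_nonneg c)

theorem free_norm_star (x : Free X) : ‖star x‖ = ‖x‖ := by
  simp only [free_norm_def, ToeplitzSeminorm.star_eq]

theorem free_norm_sq_le (x : Free X) : ‖x‖ * ‖x‖ ≤ ‖star x * x‖ := by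
  have h : ‖x‖ ≤ √‖star x * x‖ := free_norm_le fun p =>
    Real.le_sqrt_of_sq_le ((p.cstar x).symm.trans_le (p.le_norm _))
  calc ‖x‖ * ‖x‖ ≤ √‖star x * x‖ * √‖star x * x‖ := by gcongr
    _ = ‖star x * x‖ := Real.mul_self_sqrt (norm_nonneg _)

/-! ### The completion -/

/-- The Hausdorff completion of the free `*`-algebra: a unital `C*`-algebra. -/
abbrev Compl := UniformSpace.Completion (Free X)

theorem uniformContinuous_star_free : UniformContinuous (star : Free X → Free X) := by
  refine (LipschitzWith.of_dist_le_mul (K := 1) fun x y => ?_).uniformContinuous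
  rw [dist_eq_norm, dist_eq_norm, ← star_sub, free_norm_star]; simp

instance : Star (Compl X) := ⟨UniformSpace.Completion.map star⟩

theorem continuous_star_compl : Continuous (star : Compl X → Compl X) :=
  UniformSpace.Completion.continuous_map

theorem star_coe (x : Free X) : star (x : Compl X) = ((star x : Free X) : Compl X) :=
  UniformSpace.Completion.map_coe (uniformContinuous_star_free X) x

open UniformSpace.Completion in
instance : StarRing (Compl X) where
  star_involutive x := by
    have hc := continuous_star_compl X
    induction x using induction_on with
    | hp => exact isClosed_eq (hc.comp hc) continuous_id
    | ih x => rw [star_coe, star_coe, star_star]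
  star_mul x y := by
    have hc := continuous_star_compl X
    induction x, y using induction_on₂ with
    | hp => exact isClosed_eq (by fun_prop) (by fun_prop)
    | ih x y => rw [← coe_mul, star_coe, star_coe, star_coe, star_mul, coe_mul]
  star_add x y := by
    have hc := continuous_star_compl X
    induction x, y using induction_on₂ with
    | hp => exact isClosed_eq (by fun_prop) (by fun_prop)
    | ih x y => rw [← coe_add, star_coe, star_coe, star_coe, star_add, coe_add]

open UniformSpace.Completion in
instance : StarModule ℂ (Compl X) where
  star_smul c x := by
    have hc := continuous_star_compl X
    induction x using induction_on with
    | hp => exact isClosed_eq (hc.comp (continuous_const_smul c)) (hc.const_smul (star c))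
    | ih x => rw [← coe_smul, star_coe, star_coe, star_smul, coe_smul]

open UniformSpace.Completion in
instance : CStarRing (Compl X) where
  norm_mul_self_le x := by
    have hc := continuous_star_compl X
    have hn : Continuous fun y : Compl X => ‖y‖ := continuous_norm
    induction x using induction_on with
    | hp => exact isClosed_le (hn.mul hn) (hn.comp (hc.mul continuous_id))
    | ih x =>
      rw [star_coe, ← coe_mul, norm_coe, norm_coe]
      exact free_norm_sq_le X x

instance : NormedAlgebra ℂ (Compl X) where
  norm_smul_le := norm_smul_le

instance : CStarAlgebra (Compl X) where

variable {X} in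
theorem coe_eq_of_norm {x y : Free X} (h : ∀ p : ToeplitzSeminorm X, p.toFun (x - y) = 0) :
    (x : Compl X) = (y : Compl X) := by
  rw [← sub_eq_zero, ← UniformSpace.Completion.coe_sub, ← norm_eq_zero,
    UniformSpace.Completion.norm_coe, free_norm_eq_zero h]

/-! ### The Cuntz-Toeplitz algebra -/

/-- The images `Π(a)` and `T_ξ` in the completion. -/
def generators : Set (Compl X) :=
  {y | (∃ a : A, y = (gen X (.pi a) : Free X)) ∨ ∃ ξ : E, y = (gen X (.t ξ) : Free X)}

/-- The Cuntz-Toeplitz algebra: the (not necessarily unital) `C*`-algebra generated by all `Π(a)`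
and `T_ξ`, under the universal `C*`-norm. -/
def toeplitz : NonUnitalStarSubalgebra ℂ (Compl X) :=
  (NonUnitalStarAlgebra.adjoin ℂ (generators X)).topologicalClosure

/-- The Cuntz-Toeplitz algebra as a type. -/
abbrev Toeplitz := toeplitz X

instance : NonUnitalCStarAlgebra (Toeplitz X) :=
  NonUnitalStarSubalgebra.nonUnitalCStarAlgebra (toeplitz X)
    (h_closed := NonUnitalStarSubalgebra.isClosed_topologicalClosure _)

variable {X} in
theorem generators_subset {y : Compl X} (h : y ∈ generators X) : y ∈ toeplitz X :=
  NonUnitalStarSubalgebra.le_topologicalClosure _ (NonUnitalStarAlgebra.subset_adjoin ℂ _ h)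

/-- The universal representation `Π : A → 𝒯_E`. -/
def Pi : A →⋆ₙₐ[ℂ] Toeplitz X where
  toFun a := ⟨(gen X (.pi a) : Free X), generators_subset (.inl ⟨a, rfl⟩)⟩
  map_smul' c a := Subtype.ext <| by
    refine (coe_eq_of_norm fun p => p.pi_smul c a).trans ?_
    rw [UniformSpace.Completion.coe_smul]; rfl
  map_zero' := Subtype.ext <| by
    have h : ((gen X (.pi (0 : A)) : Free X) : Compl X) = ((0 : Free X) : Compl X) :=
      coe_eq_of_norm fun p => by simpa using p.pi_smul 0 0
    exact h.trans UniformSpace.Completion.coe_zero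
  map_add' a b := Subtype.ext <| by
    refine (coe_eq_of_norm fun p => p.pi_add a b).trans ?_
    rw [UniformSpace.Completion.coe_add]; rfl
  map_mul' a b := Subtype.ext <| by
    refine (coe_eq_of_norm fun p => p.pi_mul a b).trans ?_
    rw [UniformSpace.Completion.coe_mul]; rfl
  map_star' a := Subtype.ext <| by
    change _ = star ((gen X (.pi a) : Free X) : Compl X)
    rw [star_coe, star_gen]; rfl

/-- The universal generators `T_ξ`. -/
def T (ξ : E) : Toeplitz X := ⟨(gen X (.t ξ) : Free X), generators_subset (.inr ⟨ξ, rfl⟩)⟩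

theorem Pi_mul_T (a : A) (ξ : E) : Pi X a * T X ξ = T X (X.Φ a ξ) := Subtype.ext <| by
  change ((gen X (.pi a) : Free X) : Compl X) * ((gen X (.t ξ) : Free X) : Compl X) = _
  rw [← UniformSpace.Completion.coe_mul]
  exact coe_eq_of_norm fun p => p.pi_t a ξ

theorem star_T_mul_T (ξ η : E) : star (T X ξ) * T X η = Pi X (ip A ξ η) := Subtype.ext <| by
  change star ((gen X (.t ξ) : Free X) : Compl X) * ((gen X (.t η) : Free X) : Compl X) = _
  rw [star_coe, ← UniformSpace.Completion.coe_mul]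
  exact coe_eq_of_norm fun p => p.t_t ξ η

theorem norm_Pi_le (a : A) : ‖Pi X a‖ ≤ ‖a‖ := by
  change ‖((gen X (.pi a) : Free X) : Compl X)‖ ≤ _
  rw [UniformSpace.Completion.norm_coe]
  exact free_norm_le fun p => p.pi_le a

/-- `Π` as a bounded linear map. -/
def PiL : A →L[ℂ] Toeplitz X :=
  LinearMap.mkContinuous
    { toFun := Pi X, map_add' := map_add (Pi X), map_smul' := map_smul (Pi X) } 1
    fun a => by simpa using norm_Pi_le X a

/-! ### The gauge action -/

/-- The gauge action on symbols, with `z` a complex number of modulus one: `Π(a)` is fixed, `T_ξ` is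
multiplied by `z`. -/
def gaugeGen (z : ℂ) : Gen A E → Free X
  | .pi a => gen X (.pi a)
  | .t ξ => z • gen X (.t ξ)
  | .tAdj ξ => star z • gen X (.tAdj ξ)

/-- The gauge action on the free algebra. -/
def gaugeFree (z : ℂ) : Free X →ₐ[ℂ] Free X :=
  FreeAlgebra.lift ℂ (A := Free X) (gaugeGen X z)

theorem gaugeFree_gen (z : ℂ) (g : Gen A E) : gaugeFree X z (gen X g) = gaugeGen X z g :=
  FreeAlgebra.lift_ι_apply (A := Free X) (gaugeGen X z) g

theorem gaugeFree_star (z : ℂ) (x : Free X) :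
    gaugeFree X z (star x) = star (gaugeFree X z x) := by
  induction x using free_induction with
  | h0 c => rw [star_algebraMap_free, AlgHom.commutes, AlgHom.commutes, star_algebraMap_free]
  | h1 g =>
    rw [star_gen, gaugeFree_gen, gaugeFree_gen]
    cases g <;> simp [gaugeGen, Gen.adj, star_gen, star_smul]
  | hm a b ha hb => rw [star_mul, map_mul, ha, hb, map_mul, star_mul]
  | ha a b ha hb => rw [star_add, map_add, ha, hb, map_add, star_add]

/-- The seminorms that come from representations are permuted by the gauge action. -/
def ToeplitzSeminorm.gauge (p : ToeplitzSeminorm X) (z : Circle) : ToeplitzSeminorm X where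
  toFun x := p.toFun (gaugeFree X z x)
  map_zero' := by rw [map_zero]; exact p.map_zero'
  add_le' x y := by rw [map_add]; exact p.add_le' _ _
  neg' x := by rw [map_neg]; exact p.neg' _
  mul_le' x y := by rw [map_mul]; exact p.mul_le' _ _
  smul_eq c x := by rw [map_smul]; exact p.smul_eq _ _
  cstar x := by rw [map_mul, gaugeFree_star]; exact p.cstar _
  pi_le a := by rw [gaugeFree_gen]; exact p.pi_le a
  pi_add a b := by
    simp only [map_sub, map_add, gaugeFree_gen]; exact p.pi_add a b
  pi_smul c a := by
    simp only [map_sub, map_smul, gaugeFree_gen]; exact p.pi_smul c a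
  pi_mul a b := by
    simp only [map_sub, map_mul, gaugeFree_gen]; exact p.pi_mul a b
  pi_t a ξ := by
    simp only [map_sub, map_mul, gaugeFree_gen, gaugeGen, mul_smul_comm]
    rw [← smul_sub, p.smul_eq, p.pi_t, mul_zero]
  t_t ξ η := by
    have hz : (z : ℂ) * star (z : ℂ) = 1 := by
      rw [Complex.star_def, Complex.mul_conj, Circle.normSq_coe]; simp
    simp only [map_sub, map_mul, gaugeFree_star, gaugeFree_gen, gaugeGen, star_smul,
      mul_smul_comm, smul_mul_assoc, smul_smul, hz, one_smul]
    exact p.t_t ξ η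

theorem norm_gaugeFree_le (z : Circle) (x : Free X) : ‖gaugeFree X z x‖ ≤ ‖x‖ :=
  free_norm_le fun p => (p.gauge X z).le_norm x

theorem continuous_gaugeFree (z : Circle) : Continuous (gaugeFree X z : Free X →+* Free X) :=
  AddMonoidHomClass.continuous_of_bound (gaugeFree X z : Free X →+* Free X) 1
    fun x => by simpa using norm_gaugeFree_le X z x

/-- The gauge action on the completion. -/
def gaugeCompl (z : Circle) : Compl X →⋆ₐ[ℂ] Compl X where
  __ := UniformSpace.Completion.mapRingHom (gaugeFree X z : Free X →+* Free X)
    (continuous_gaugeFree X z)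
  commutes' c := by
    change UniformSpace.Completion.mapRingHom _ _ ((algebraMap ℂ (Free X) c : Free X) : Compl X) = _
    rw [UniformSpace.Completion.mapRingHom_coe]
    exact congrArg _ ((gaugeFree X z).commutes c)
  map_star' x := by
    change UniformSpace.Completion.mapRingHom _ _ _ = star (UniformSpace.Completion.mapRingHom _ _ _)
    have hc := continuous_star_compl X
    have hm : Continuous (UniformSpace.Completion.mapRingHom
        (gaugeFree X z : Free X →+* Free X) (continuous_gaugeFree X z)) :=
      UniformSpace.Completion.continuous_map
    induction x using UniformSpace.Completion.induction_on with
    | hp => exact isClosed_eq (hm.comp hc) (hc.comp hm)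
    | ih x =>
      rw [star_coe, UniformSpace.Completion.mapRingHom_coe,
        UniformSpace.Completion.mapRingHom_coe, star_coe]
      exact congrArg _ (gaugeFree_star X z x)

theorem gaugeCompl_coe (z : Circle) (x : Free X) :
    gaugeCompl X z (x : Compl X) = (gaugeFree X z x : Free X) :=
  UniformSpace.Completion.mapRingHom_coe (continuous_gaugeFree X z) x

theorem continuous_gaugeCompl (z : Circle) : Continuous (gaugeCompl X z) :=
  UniformSpace.Completion.continuous_map

theorem gaugeCompl_mem (z : Circle) {y : Compl X} (hy : y ∈ toeplitz X) :
    gaugeCompl X z y ∈ toeplitz X := by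
  have h1 : NonUnitalStarAlgebra.adjoin ℂ (generators X) ≤
      (toeplitz X).comap (gaugeCompl X z) := by
    refine NonUnitalStarAlgebra.adjoin_le ?_
    rintro _ (⟨a, rfl⟩ | ⟨ξ, rfl⟩)
    · change gaugeCompl X z _ ∈ toeplitz X
      rw [gaugeCompl_coe, gaugeFree_gen]
      exact generators_subset (.inl ⟨a, rfl⟩)
    · change gaugeCompl X z _ ∈ toeplitz X
      rw [gaugeCompl_coe, gaugeFree_gen]
      change ((((z : ℂ) • gen X (.t ξ) : Free X)) : Compl X) ∈ toeplitz X
      rw [UniformSpace.Completion.coe_smul]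
      exact (toeplitz X).smul_mem (z : ℂ) (generators_subset (.inr ⟨ξ, rfl⟩))
  exact closure_minimal h1 ((NonUnitalStarSubalgebra.isClosed_topologicalClosure _).preimage
    (continuous_gaugeCompl X z)) hy

/-- The gauge action `γ` of `ℝ` on the Cuntz-Toeplitz algebra. -/
def gauge (s : ℝ) : Toeplitz X →⋆ₙₐ[ℂ] Toeplitz X :=
  NonUnitalStarAlgHom.codRestrict
    (((gaugeCompl X (Circle.exp s) : Compl X →⋆ₐ[ℂ] Compl X) :
      Compl X →⋆ₙₐ[ℂ] Compl X).comp (NonUnitalStarSubalgebraClass.subtype (toeplitz X)))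
    (toeplitz X) fun y => gaugeCompl_mem X (Circle.exp s) y.2

theorem gauge_Pi (s : ℝ) (a : A) : gauge X s (Pi X a) = Pi X a := Subtype.ext <| by
  refine (gaugeCompl_coe X _ _).trans ?_
  rw [gaugeFree_gen]; rfl

theorem gauge_T (s : ℝ) (ξ : E) :
    gauge X s (T X ξ) = Complex.exp (s * Complex.I) • T X ξ := Subtype.ext <| by
  refine (gaugeCompl_coe X _ _).trans ?_
  rw [gaugeFree_gen, ← Circle.coe_exp]
  exact UniformSpace.Completion.coe_smul _ _

end Toeplitz

/-! ### KMS states and traces -/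

/-- A state of a `C*`-algebra: a positive linear functional of norm one. -/
structure IsState {B : Type*} [NonUnitalCStarAlgebra B] (ω : B →L[ℂ] ℂ) : Prop where
  nonneg : ∀ x : B, 0 ≤ ω (star x * x)
  norm_eq_one : ‖ω‖ = 1

/-- A `β`-KMS state for the action `α` of `ℝ`: a state `ω` with `ω (x α_{iβ}(y)) = ω (y x)` for all
`x` and all entire `y`, where `y` is entire if `s ↦ α_s(y)` extends to an entire function `f`, and
then `α_{iβ}(y) = f (iβ)`. -/
structure IsKMSState {B : Type*} [NonUnitalCStarAlgebra B] (α : ℝ → B →⋆ₙₐ[ℂ] B) (β : ℝ)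
    (ω : B →L[ℂ] ℂ) : Prop where
  isState : IsState ω
  kms : ∀ (x y : B) (f : ℂ → B), Differentiable ℂ f → (∀ s : ℝ, f s = α s y) →
    ω (x * f (β * Complex.I)) = ω (y * x)

/-- A finite trace of a `C*`-algebra: an everywhere defined (hence bounded) positive linear
functional with the trace property. -/
structure IsFiniteTrace {B : Type*} [NonUnitalCStarAlgebra B] (τ : B →L[ℂ] ℂ) : Prop where
  nonneg : ∀ x : B, 0 ≤ τ (star x * x)
  tracial : ∀ x y : B, τ (x * y) = τ (y * x)

section KMS

variable {A E : Type*} [NonUnitalCStarAlgebra A] [PartialOrder A] [StarOrderedRing A]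
  [NormedAddCommGroup E] [NormedSpace ℂ E] [SMul Aᵐᵒᵖ E] [CStarModule Aᵐᵒᵖ E]

/-- The `β`-KMS states of infinite type for the gauge action: those with
`∑_{ξ ∈ Λ} ω(T_ξ T_ξ^*) = 1`. Sums over `Λ` are limits over the finite subsets of `Λ`. -/
def infiniteKMS (X : Correspondence A E) (Λ : Set E) (β : ℝ) : Set (Toeplitz X →L[ℂ] ℂ) :=
  {ω | IsKMSState (gauge X) β ω ∧
    HasSum (fun ξ : Λ => ω (T X (ξ : E) * star (T X (ξ : E)))) 1}

/-- The finite traces `τ` with `e^{-β} ∑_{ξ ∈ Λ} τ(⟨ξ, ξ⟩) = 1` and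
`e^{-β} ∑_{ξ ∈ Λ} τ(⟨ξ, Φ(a) ξ⟩) = τ(a)` for all `a`. -/
def scalingTraces (X : Correspondence A E) (Λ : Set E) (β : ℝ) : Set (A →L[ℂ] ℂ) :=
  {τ | IsFiniteTrace τ ∧
    HasSum (fun ξ : Λ => (Real.exp (-β) : ℂ) * τ (ip A (ξ : E) (ξ : E))) 1 ∧
    ∀ a : A, HasSum (fun ξ : Λ => (Real.exp (-β) : ℂ) * τ (ip A (ξ : E) (X.Φ a (ξ : E)))) (τ a)}

/-- The restriction map `ω ↦ ω ∘ Π`. -/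
def restriction (X : Correspondence A E) (ω : Toeplitz X →L[ℂ] ℂ) : A →L[ℂ] ℂ :=
  ω.comp (PiL X)

end KMS

end

end CuntzToeplitz

/-!
The restriction map is studied through words `T_{ξ₁} ⋯ T_{ξₙ} c T_{η_m}^* ⋯ T_{η₁}^*`, with `c = 1`
or `c = Π(a)`. They span a dense subspace of the unital `C*`-algebra `Compl X` that contains `𝒯_E`
as an ideal, and the gauge action multiplies a word of degree `d = n - m` by a character
(`IsWord.gaugeCompl`), so that the KMS condition for a word reads `e^{-dβ} ω(x y) = ω(y x)`.

*Frames.* The approximate unit property makes the partial sums `∑_{ξ ∈ F} θ_{ξ,ξ}` contractive and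
convergent to the identity at each vector (`IsFrame.norm_frameSum_le`, `IsFrame.tendsto_frameSum`).
Hence the elements `∑_{ξ ∈ F} T_ξ T_ξ^*` are contractive too (`norm_rangeSum_le`), and along them a
state of infinite type behaves as along an approximate unit (`IsState.tendsto_map_mul_left`).

*The restriction is well defined and injective.* Inserting `∑_{ξ ∈ F} T_ξ T_ξ^*` into `ω(Π(a))` and
commuting `T_ξ` past the rest gives the scaling condition. Inserting it on either side of a word of
degree `d` gives `e^{-dβ} ω(y) = ω(y)`, so that `ω` vanishes if `d ≠ 0`. In degree zero the KMS
condition `ω(T_ξ x T_η^*) = e^{-β} ω(x Π(⟨η, ξ⟩))` shortens words until only `ω ∘ Π` is left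
(`injOn_restriction`).

*The restriction is surjective.* For a trace `τ` that satisfies the scaling condition, the form
`⟨u, v⟩ = τ(⟨u, v⟩_A)` on the Fock space without its degree zero part is positive, which the frame
proves by induction on the tensor length (`IsFrame.fockForm_nonneg`). The Toeplitz relations hold
for creation and annihilation operators, so the vector functionals extend to `Compl X`, and those of the
vectors `ζ ∈ Λ` of degree one sum, up to the factor `e^{-β}`, to a gauge invariant functional with
restriction `τ` (`exists_isTraceExtension`). The map `φ ↦ e^{-β} ∑_ζ φ(T_ζ^* · T_ζ)` preserves such
functionals, and `τ` being a trace makes its iterates converge, since their values at a word become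
constant; the limit `ω` satisfies `ω(T_ξ x T_η^*) = e^{-β} ω(x Π(⟨η, ξ⟩))`
(`exists_invariant_isTraceExtension`), from which the KMS condition for all words follows
(`IsTraceExtension.isKMSElement`). For an arbitrary entire element `y` the two sides of the KMS
condition are entire functions of period `2π`, approximated uniformly on the real line by those of
linear combinations of words; the three lines theorem carries the approximation into the strip
(`eq_shift_of_approx`, `kms_of_isKMSElement`).

*Nondegenerate actions.* An approximate unit `e` of `A` acts on `E` as an approximate identity, and
`τ(e) ≥ e^{-β} ∑_{ξ ∈ F} τ(⟨ξ, Φ(e) ξ⟩)` then gives `‖τ‖ ≥ 1` (`isState_of_nondegenerate`).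
-/

namespace CuntzToeplitz

noncomputable section

open Filter Topology

/-! ### Adjointable operators and the left action -/

section UnitizationSqrt

variable {A : Type*} [NonUnitalCStarAlgebra A]

/-- In the unitization, `‖a‖² - a* a` is `y* y` for some `y = c + b`; here this identity is spelled
out in `A`. It makes every `*`-representation of `A`, on any kind of semi-inner product space,
contractive. -/
theorem exists_scalar_add_sqrt (a : A) : ∃ (c : ℂ) (b : A),
    star c * c = ((‖a‖ ^ 2 : ℝ) : ℂ) ∧
      star c • b + c • star b + star b * b = -(star a * a) := by
  let : PartialOrder (Unitization ℂ A) := CStarAlgebra.spectralOrder _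
  have : StarOrderedRing (Unitization ℂ A) := CStarAlgebra.spectralOrderedRing _
  have h := CStarAlgebra.star_mul_le_algebraMap_norm_sq (a := (a : Unitization ℂ A))
  rw [← sub_nonneg, CStarAlgebra.nonneg_iff_eq_star_mul_self, Unitization.norm_inr] at h
  obtain ⟨y, hy⟩ := h
  rw [sub_eq_iff_eq_add, Algebra.algebraMap_eq_smul_one] at hy
  have h1 := congrArg (fun z : Unitization ℂ A => z.fst) hy
  have h2 := congrArg (fun z : Unitization ℂ A => z.snd) hy
  simp only [Unitization.fst_add, Unitization.snd_add, Unitization.fst_smul, Unitization.snd_smul,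
    Unitization.fst_one, Unitization.snd_one, Unitization.fst_mul, Unitization.snd_mul,
    Unitization.fst_star, Unitization.snd_star, Unitization.fst_inr, Unitization.snd_inr] at h1 h2
  refine ⟨y.fst, y.snd, ?_, ?_⟩
  · simpa using h1.symm
  · rw [eq_neg_iff_add_eq_zero]
    simpa using h2.symm

end UnitizationSqrt

section Module

variable {A E : Type*} [NonUnitalCStarAlgebra A] [PartialOrder A] [StarOrderedRing A]
  [NormedAddCommGroup E] [NormedSpace ℂ E] [SMul Aᵐᵒᵖ E] [CStarModule Aᵐᵒᵖ E]

theorem ip_add_left (ξ η ζ : E) : ip A (ξ + η) ζ = ip A ξ ζ + ip A η ζ := by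
  rw [← star_ip, ip_add_right, star_add, star_ip, star_ip]

theorem ip_smul_left (ξ η : E) (c : ℂ) : ip A (c • ξ) η = star c • ip A ξ η := by
  rw [← star_ip, ip_smul_right, star_smul, star_ip]

theorem ip_sub_right (ξ η ζ : E) : ip A ξ (η - ζ) = ip A ξ η - ip A ξ ζ := by
  simp [ip]

theorem ip_sub_left (ξ η ζ : E) : ip A (ξ - η) ζ = ip A ξ ζ - ip A η ζ := by
  simp [ip]

theorem ip_zero_right (ξ : E) : ip A ξ 0 = 0 := by simp [ip]

theorem ip_zero_left (ξ : E) : ip A 0 ξ = 0 := by simp [ip]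

theorem rsmul_sub_left (ξ η : E) (a : A) : rsmul (ξ - η) a = rsmul ξ a - rsmul η a :=
  ext_ip (A := A) fun ζ => by simp only [ip_sub_right, ip_rsmul, sub_mul]

theorem ip_rsmul_left (ξ η : E) (a : A) : ip A (rsmul ξ a) η = star a * ip A ξ η := by
  rw [← star_ip, ip_rsmul, star_mul, star_ip]

/-- The inner product as a bounded linear map in its second variable. -/
def ipL (A : Type*) {E : Type*} [NonUnitalCStarAlgebra A] [PartialOrder A] [StarOrderedRing A]
    [NormedAddCommGroup E] [NormedSpace ℂ E] [SMul Aᵐᵒᵖ E] [CStarModule Aᵐᵒᵖ E] (ξ : E) :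
    E →L[ℂ] A :=
  LinearMap.mkContinuous
    { toFun := ip A ξ
      map_add' := ip_add_right ξ
      map_smul' := fun c η => ip_smul_right ξ η c } ‖ξ‖ (norm_ip_le ξ)

theorem ipL_apply (ξ η : E) : ipL A ξ η = ip A ξ η := rfl

theorem theta_apply (ξ η ζ : E) : theta A ξ η ζ = rsmul ξ (ip A η ζ) := rfl

/-- The left action is contractive. -/
theorem Correspondence.norm_Φ_le (X : Correspondence A E) (a : A) (ξ : E) :
    ‖X.Φ a ξ‖ ≤ ‖a‖ * ‖ξ‖ := by
  obtain ⟨c, b, hc, hb⟩ := exists_scalar_add_sqrt a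
  have h : ip A (c • ξ + X.Φ b ξ) (c • ξ + X.Φ b ξ) =
      ((‖a‖ ^ 2 : ℝ) : ℂ) • ip A ξ ξ - ip A (X.Φ a ξ) (X.Φ a ξ) := by
    have h1 : ip A ξ (X.Φ (star c • b + c • star b + star b * b) ξ) =
        - ip A (X.Φ a ξ) (X.Φ a ξ) := by
      rw [hb, X.adjoint, map_neg, map_mul, ← ipL_apply, ← ipL_apply, neg_apply, map_neg]
      rfl
    rw [← hc, sub_eq_add_neg, ← h1]
    simp only [ip_add_left, ip_add_right, ip_smul_left, ip_smul_right, map_add, map_smul, map_mul,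
      add_apply, smul_apply, mul_apply_eq_comp, X.adjoint, smul_add, smul_smul, mul_comm c]
    abel
  refine le_of_sq_le ?_ (by positivity)
  have hle : ip A (X.Φ a ξ) (X.Φ a ξ) ≤ ((‖a‖ ^ 2 : ℝ) : ℂ) • ip A ξ ξ := by
    rw [← sub_nonneg, ← h]
    exact ip_self_nonneg _
  have := CStarAlgebra.norm_le_norm_of_nonneg_of_le (ip_self_nonneg _) hle
  rw [norm_smul, Complex.norm_real, ← norm_sq_eq_norm_ip, ← norm_sq_eq_norm_ip,
    Real.norm_of_nonneg (by positivity)] at this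
  rwa [mul_pow]

/-- The left action on a fixed vector, as a bounded linear map. -/
def Correspondence.orbit (X : Correspondence A E) (ξ : E) : A →L[ℂ] E :=
  LinearMap.mkContinuous
    { toFun := fun a => X.Φ a ξ
      map_add' := fun a b => by simp
      map_smul' := fun c a => by simp } ‖ξ‖ fun a => by
    rw [mul_comm]; exact X.norm_Φ_le a ξ

/-! ### Frames -/

/-- The partial sum `∑_{ξ ∈ F} θ_{ξ,ξ}` of a frame. -/
def frameSum (A : Type*) {E : Type*} [NonUnitalCStarAlgebra A] [PartialOrder A] [StarOrderedRing A]
    [NormedAddCommGroup E] [NormedSpace ℂ E] [SMul Aᵐᵒᵖ E] [CStarModule Aᵐᵒᵖ E]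
    {Λ : Set E} (F : Finset Λ) : E →L[ℂ] E := ∑ ξ ∈ F, theta A (ξ : E) (ξ : E)

variable {Λ : Set E}

theorem theta_mem_compacts (ξ η : E) : theta A ξ η ∈ compacts A E :=
  Submodule.le_topologicalClosure _ (Submodule.subset_span ⟨ξ, η, rfl⟩)

theorem frameSum_mem_compacts (F : Finset Λ) : frameSum A F ∈ compacts A E :=
  Submodule.sum_mem _ fun _ _ => theta_mem_compacts _ _

theorem ip_frameSum (F : Finset Λ) (x y : E) :
    ip A x (frameSum A F y) = ∑ ξ ∈ F, ip A x (ξ : E) * ip A (ξ : E) y := by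
  rw [frameSum, ← ipL_apply, sum_apply, map_sum]
  simp only [ipL_apply, theta_apply, ip_rsmul]

theorem frameSum_adjoint (F : Finset Λ) (x y : E) :
    ip A (frameSum A F x) y = ip A x (frameSum A F y) := by
  rw [← star_ip, ip_frameSum, ip_frameSum, star_sum]
  simp only [star_mul, star_ip]

theorem frameSum_rsmul (F : Finset Λ) (x : E) (a : A) :
    frameSum A F (rsmul x a) = rsmul (frameSum A F x) a :=
  ext_ip (A := A) fun ζ => by
    rw [← frameSum_adjoint, ip_rsmul, ip_rsmul, frameSum_adjoint]

theorem ip_frameSum_mono {F G : Finset Λ} (h : F ⊆ G) (x : E) :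
    ip A x (frameSum A F x) ≤ ip A x (frameSum A G x) := by
  rw [ip_frameSum, ip_frameSum]
  refine Finset.sum_le_sum_of_subset_of_nonneg h fun ξ _ _ => ?_
  rw [← star_ip]
  exact star_mul_self_nonneg _

theorem ip_frameSum_nonneg (F : Finset Λ) (x : E) : 0 ≤ ip A x (frameSum A F x) := by
  simpa [frameSum, ← ipL_apply] using ip_frameSum_mono (A := A) (Finset.empty_subset F) x

/-- The Cauchy-Schwarz inequality for the positive semidefinite form `⟨x, S y⟩` with `S` a partial
frame sum. -/
theorem norm_sq_ip_frameSum_le (F : Finset Λ) (x y : E) {s : ℝ} (hs : 0 < s)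
    (h : ‖ip A x (frameSum A F x)‖ ≤ s) :
    ‖ip A x (frameSum A F y)‖ ^ 2 ≤ s * ‖ip A y (frameSum A F y)‖ := by
  obtain ⟨S, hS⟩ : ∃ S, S = frameSum (Λ := Λ) A F := ⟨_, rfl⟩
  rw [← hS] at h ⊢
  obtain ⟨b, hb⟩ : ∃ b, b = ip A x (S y) := ⟨_, rfl⟩
  rw [← hb]
  have hbs : ip A y (S x) = star b := by rw [hb, star_ip, hS, frameSum_adjoint]
  have hr : ∀ (w z : E) (a : A), ip A w (S (rsmul z a)) = ip A w (S z) * a := fun w z a => by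
    rw [hS, frameSum_rsmul, ip_rsmul]
  have h0 : 0 ≤ star b * ip A x (S x) * b - (s : ℂ) • (star b * b) - (s : ℂ) • (star b * b)
      + (s : ℂ) • (s : ℂ) • ip A y (S y) := by
    refine (hS ▸ ip_frameSum_nonneg F (rsmul x b - (s : ℂ) • y)).trans_eq ?_
    simp only [map_sub, map_smul, ip_sub_left, ip_sub_right, ip_smul_left, ip_smul_right,
      ip_rsmul_left, hr, hbs, ← hb, RCLike.star_def, Complex.conj_ofReal, smul_sub, sub_mul,
      smul_mul_assoc, mul_assoc]
    abel
  have h1 : star b * ip A x (S x) * b ≤ (s : ℂ) • (star b * b) := by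
    refine (CStarAlgebra.star_left_conjugate_le_norm_smul
      (hb := IsSelfAdjoint.of_nonneg (hS ▸ ip_frameSum_nonneg F x))).trans ?_
    rw [Complex.coe_smul]
    exact smul_le_smul_of_nonneg_right h (star_mul_self_nonneg b)
  have h2 : (s : ℂ) • (star b * b) ≤ (s : ℂ) • (s : ℂ) • ip A y (S y) := by
    have h3 := add_nonneg h0 (sub_nonneg.2 h1)
    rw [← sub_nonneg]
    convert h3 using 1
    abel
  have hs' : (0 : ℂ) ≤ s := by exact_mod_cast hs.le
  have h3 := CStarAlgebra.norm_le_norm_of_nonneg_of_le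
    (smul_nonneg hs' (star_mul_self_nonneg b)) h2
  rw [norm_smul, norm_smul, norm_smul, Complex.norm_real, Real.norm_of_nonneg hs.le,
    CStarRing.norm_star_mul_self, ← pow_two] at h3
  exact le_of_mul_le_mul_left h3 hs

theorem IsFrame.ip_frameSum_le (hΛ : IsFrame A Λ) (F : Finset Λ) (y : E) :
    ip A (frameSum A F y) (frameSum A F (frameSum A F y)) ≤
      ip A (frameSum A F y) (frameSum A F y) := by
  have h := (hΛ _ (frameSum_mem_compacts F)).1
  have h1 : Tendsto (fun G : Finset Λ => ip A (frameSum A F y) (frameSum A G (frameSum A F y)))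
      atTop (𝓝 (ip A (frameSum A F y) (frameSum A F y))) :=
    ((ipL A (frameSum A F y)).continuous.tendsto _).comp
      (((ContinuousLinearMap.apply ℂ E y).continuous.tendsto _).comp h)
  exact ge_of_tendsto h1 ((eventually_ge_atTop F).mono fun G hG => ip_frameSum_mono hG _)

/-- The partial sums of a frame are contractive: with `S` a partial sum, `S³ ≤ S²` by monotonicity
and the approximate unit property. -/
theorem IsFrame.norm_frameSum_le (hΛ : IsFrame A Λ) (F : Finset Λ) (y : E) :
    ‖frameSum A F y‖ ≤ ‖y‖ := by
  set S := frameSum A F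
  -- `S` is contractive on its range
  have h1 : ∀ y, ‖S (S y)‖ ≤ ‖S y‖ := fun y => by
    by_contra! hlt
    have hpos : 0 < ‖S (S y)‖ := (norm_nonneg _).trans_lt hlt
    have h2 : ∀ z, ‖ip A (S z) (S (S z))‖ ≤ ‖S z‖ ^ 2 := fun z => by
      rw [norm_sq_eq_norm_ip (A := A)]
      exact CStarAlgebra.norm_le_norm_of_nonneg_of_le (ip_frameSum_nonneg F _)
        (hΛ.ip_frameSum_le F z)
    have h3 := norm_sq_ip_frameSum_le (A := A) F (S (S y)) (S y) (pow_pos hpos 2) (h2 (S y))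
    rw [← norm_sq_eq_norm_ip (A := A)] at h3
    have h4 := h3.trans (mul_le_mul_of_nonneg_left (h2 y) (by positivity))
    rw [pow_two (‖S (S y)‖ ^ 2)] at h4
    have h5 := le_of_mul_le_mul_left h4 (by positivity)
    exact hlt.not_ge (le_of_sq_le h5 (norm_nonneg _))
  by_contra! hlt
  have h2 : ‖S y‖ ^ 2 ≤ ‖y‖ * ‖S y‖ := by
    rw [norm_sq_eq_norm_ip (A := A), frameSum_adjoint]
    exact (norm_ip_le _ _).trans (mul_le_mul_of_nonneg_left (h1 y) (norm_nonneg _))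
  rw [pow_two] at h2
  exact hlt.not_ge (le_of_mul_le_mul_right h2 ((norm_nonneg _).trans_lt hlt))

theorem norm_pow_three_le (x : E) : ‖x‖ ^ 3 ≤ ‖rsmul x (ip A x x)‖ := by
  rcases (norm_nonneg x).eq_or_lt with h0 | h0
  · rw [← h0]; simp
  have h : IsSelfAdjoint (ip A x x) := star_ip _ _
  have h2 := norm_ip_le (A := A) x (rsmul x (ip A x x))
  rw [ip_rsmul, h.norm_mul_self, ← norm_sq_eq_norm_ip] at h2
  refine le_of_mul_le_mul_left (le_trans (le_of_eq ?_) h2) h0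
  ring

/-- A frame reconstructs every vector. With `D = 1 - S` for a partial sum `S` and `x = D y`, one has
`x · ⟨x, x⟩ = D θ_{y,y} D x`, so `‖D y‖² ≤ 2 ‖D θ_{y,y}‖`. -/
theorem IsFrame.tendsto_frameSum (hΛ : IsFrame A Λ) (y : E) :
    Tendsto (fun F : Finset Λ => frameSum A F y) atTop (𝓝 y) := by
  have hle : ∀ F : Finset Λ,
      ‖y - frameSum A F y‖ ^ 2 ≤ 2 * ‖theta A y y - frameSum A F * theta A y y‖ := fun F => by
    obtain ⟨S, hS⟩ : ∃ S, S = frameSum (Λ := Λ) A F := ⟨_, rfl⟩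
    obtain ⟨x, hx⟩ : ∃ x, x = y - S y := ⟨_, rfl⟩
    rw [← hS, ← hx]
    have hip : ip A y (x - S x) = ip A x x := by
      conv_rhs => rw [hx, ip_sub_left, ← hx]
      rw [ip_sub_right, hS, frameSum_adjoint]
    have hrs : rsmul x (ip A x x) = (theta A y y - S * theta A y y) (x - S x) := by
      rw [sub_apply, mul_apply_eq_comp, theta_apply, hip, hS, frameSum_rsmul, ← rsmul_sub_left,
        ← hS, ← hx]
    have h1 : ‖x - S x‖ ≤ 2 * ‖x‖ := by
      have := norm_sub_le x (S x)
      linarith [hS ▸ hΛ.norm_frameSum_le F x]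
    have h2 := norm_pow_three_le (A := A) x
    rw [hrs] at h2
    have h3 := h2.trans ((ContinuousLinearMap.le_opNorm _ _).trans
      (mul_le_mul_of_nonneg_left h1 (norm_nonneg _)))
    rcases (norm_nonneg x).eq_or_lt with h0 | h0
    · rw [← h0]; simp
    · refine le_of_mul_le_mul_right (le_trans (le_of_eq ?_) (h3.trans (le_of_eq ?_))) h0 <;> ring
  have h := (hΛ _ (theta_mem_compacts y y)).1
  have h1 : Tendsto (fun F : Finset Λ => 2 * ‖theta A y y - frameSum A F * theta A y y‖)
      atTop (𝓝 0) := by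
    simpa [frameSum] using (((tendsto_const_nhds (x := theta A y y)).sub h).norm).const_mul 2
  have h2 : Tendsto (fun F : Finset Λ => ‖y - frameSum A F y‖ ^ 2) atTop (𝓝 0) :=
    squeeze_zero (fun _ => by positivity) hle h1
  have h3 : Tendsto (fun F : Finset Λ => ‖y - frameSum A F y‖) atTop (𝓝 0) := by
    simpa using h2.sqrt
  rw [tendsto_iff_norm_sub_tendsto_zero]
  simpa only [norm_sub_rev] using h3

theorem IsFrame.hasSum_ip_mul_ip (hΛ : IsFrame A Λ) (x y : E) :
    HasSum (fun ξ : Λ => ip A x (ξ : E) * ip A (ξ : E) y) (ip A x y) := by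
  have h := ((ipL A x).continuous.tendsto _).comp (hΛ.tendsto_frameSum y)
  refine h.congr fun F => ?_
  rw [← ip_frameSum]
  rfl

end Module

/-! ### The generators and the words in them -/

section Words

variable {A E : Type*} [NonUnitalCStarAlgebra A] [PartialOrder A] [StarOrderedRing A]
  [NormedAddCommGroup E] [NormedSpace ℂ E] [SMul Aᵐᵒᵖ E] [CStarModule Aᵐᵒᵖ E]
  (X : Correspondence A E)

/-- `Π` with values in the unital algebra that contains the Cuntz-Toeplitz algebra. -/
def piC : A →⋆ₙₐ[ℂ] Compl X := (NonUnitalStarSubalgebraClass.subtype (toeplitz X)).comp (Pi X)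

theorem coe_Pi (a : A) : ((Pi X a : Toeplitz X) : Compl X) = piC X a := rfl

theorem norm_piC_le (a : A) : ‖piC X a‖ ≤ ‖a‖ := norm_Pi_le X a

theorem continuous_piC : Continuous (piC X) :=
  AddMonoidHomClass.continuous_of_bound (piC X) 1 fun a => by simpa using norm_piC_le X a

theorem star_coe_T_mul_coe_T (ξ η : E) :
    star (T X ξ : Compl X) * (T X η : Compl X) = piC X (ip A ξ η) :=
  congrArg Subtype.val (star_T_mul_T X ξ η)

theorem norm_coe_T_le (ξ : E) : ‖(T X ξ : Compl X)‖ ≤ ‖ξ‖ := by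
  refine le_of_sq_le ?_ (norm_nonneg _)
  rw [norm_sq_eq_norm_ip (A := A) ξ, pow_two, ← CStarRing.norm_star_mul_self, star_coe_T_mul_coe_T]
  exact norm_piC_le X _

/-- `ξ ↦ T_ξ` is a bounded linear map; linearity is a consequence of the relation
`T_ξ^* T_η = Π(⟨ξ, η⟩)`. -/
def tC : E →L[ℂ] Compl X :=
  LinearMap.mkContinuous
    { toFun := fun ξ => (T X ξ : Compl X)
      map_add' := fun ξ η => by
        rw [← sub_eq_zero, ← CStarRing.star_mul_self_eq_zero_iff]
        simp only [star_sub, star_add, sub_mul, mul_sub, add_mul, mul_add, star_coe_T_mul_coe_T,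
          ip_add_left, ip_add_right, map_add]
        abel
      map_smul' := fun c ξ => by
        rw [← sub_eq_zero, ← CStarRing.star_mul_self_eq_zero_iff]
        simp only [star_sub, star_smul, sub_mul, mul_sub, star_coe_T_mul_coe_T, RingHom.id_apply,
          ip_smul_left, ip_smul_right, map_smul, smul_mul_assoc, mul_smul_comm]
        rw [smul_comm c, sub_self, sub_self, smul_zero, sub_zero] } 1
    fun ξ => by simpa using norm_coe_T_le X ξ

theorem coe_T (ξ : E) : (T X ξ : Compl X) = tC X ξ := rfl

theorem norm_tC_le (ξ : E) : ‖tC X ξ‖ ≤ ‖ξ‖ := norm_coe_T_le X ξ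

theorem star_tC_mul_tC (ξ η : E) : star (tC X ξ) * tC X η = piC X (ip A ξ η) :=
  star_coe_T_mul_coe_T X ξ η

theorem piC_mul_tC (a : A) (ξ : E) : piC X a * tC X ξ = tC X (X.Φ a ξ) :=
  congrArg Subtype.val (Pi_mul_T X a ξ)

theorem star_tC_mul_piC (a : A) (ξ : E) :
    star (tC X ξ) * piC X a = star (tC X (X.Φ (star a) ξ)) := by
  rw [← piC_mul_tC, star_mul, ← map_star (piC X), star_star]

theorem tC_mul_piC (ξ : E) (a : A) : tC X ξ * piC X a = tC X (rsmul ξ a) := by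
  rw [← sub_eq_zero, ← CStarRing.star_mul_self_eq_zero_iff, star_sub, star_mul]
  have h1 : star (tC X ξ) * tC X (rsmul ξ a) = piC X (ip A ξ ξ * a) := by
    rw [star_tC_mul_tC, ip_rsmul]
  have h2 : star (tC X (rsmul ξ a)) * tC X ξ = piC X (star a * ip A ξ ξ) := by
    rw [star_tC_mul_tC, ip_rsmul_left]
  have h3 : star (tC X (rsmul ξ a)) * tC X (rsmul ξ a) = piC X (star a * ip A ξ ξ * a) := by
    rw [star_tC_mul_tC, ip_rsmul, ip_rsmul_left]
  calc _ = star (piC X a) * (star (tC X ξ) * tC X ξ) * piC X a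
        - star (piC X a) * (star (tC X ξ) * tC X (rsmul ξ a))
        - (star (tC X (rsmul ξ a)) * tC X ξ * piC X a
          - star (tC X (rsmul ξ a)) * tC X (rsmul ξ a)) := by noncomm_ring
    _ = 0 := by
      rw [h1, h2, h3, star_tC_mul_tC]
      simp only [← map_star (piC X), ← map_mul, mul_assoc, sub_self]

/-! ### The partial sums of the range projections -/

variable {Λ : Set E}

/-- The partial sum `∑_{ξ ∈ F} T_ξ T_ξ^*`. -/
def rangeSum (F : Finset Λ) : Toeplitz X :=
  ∑ ξ ∈ F, T X (ξ : E) * star (T X (ξ : E))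

theorem coe_rangeSum (F : Finset Λ) :
    (rangeSum X F : Compl X) = ∑ ξ ∈ F, tC X (ξ : E) * star (tC X (ξ : E)) := by
  rw [rangeSum, ← NonUnitalStarSubalgebraClass.subtype_apply, map_sum]
  rfl

theorem star_rangeSum (F : Finset Λ) : star (rangeSum X F) = rangeSum X F := by
  simp [rangeSum, star_sum]

theorem coe_rangeSum_mul_tC (F : Finset Λ) (η : E) :
    (rangeSum X F : Compl X) * tC X η = tC X (frameSum A F η) := by
  rw [coe_rangeSum, Finset.sum_mul, frameSum, sum_apply, map_sum]
  refine Finset.sum_congr rfl fun ξ _ => ?_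
  rw [mul_assoc, star_tC_mul_tC, tC_mul_piC, theta_apply]

theorem coe_rangeSum_pow (F : Finset Λ) (n : ℕ) :
    (rangeSum X F : Compl X) ^ (n + 1) =
      ∑ ξ ∈ F, tC X ((frameSum A F ^ n) (ξ : E)) * star (tC X (ξ : E)) := by
  induction n with
  | zero => rw [zero_add, pow_one, coe_rangeSum]; rfl
  | succ n ih =>
    rw [pow_succ', ih, Finset.mul_sum]
    refine Finset.sum_congr rfl fun ξ _ => ?_
    rw [← mul_assoc, coe_rangeSum_mul_tC, pow_succ']
    rfl

/-- The powers of `∑_{ξ ∈ F} T_ξ T_ξ^*` are bounded, because the partial frame sums are contractive;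
as this element is selfadjoint, it is itself contractive. -/
theorem norm_rangeSum_le (hΛ : IsFrame A Λ) (F : Finset Λ) : ‖rangeSum X F‖ ≤ 1 := by
  change ‖(rangeSum X F : Compl X)‖ ≤ 1
  have hpow : ∀ (n : ℕ) (y : E), ‖(frameSum A F ^ n) y‖ ≤ ‖y‖ := fun n => by
    induction n with
    | zero => intro y; simp
    | succ n ih =>
      intro y
      rw [pow_succ]
      exact (ih _).trans (hΛ.norm_frameSum_le F y)
  have hb : ∀ n : ℕ, ‖(rangeSum X F : Compl X) ^ (n + 1)‖ ≤ ∑ ξ ∈ F, ‖(ξ : E)‖ * ‖(ξ : E)‖ :=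
    fun n => by
    rw [coe_rangeSum_pow]
    refine norm_sum_le_of_le _ fun ξ _ => (norm_mul_le _ _).trans ?_
    rw [norm_star]
    exact mul_le_mul ((norm_tC_le X _).trans (hpow n _)) (norm_tC_le X _) (norm_nonneg _)
      (norm_nonneg _)
  have hsa : IsSelfAdjoint (rangeSum X F : Compl X) :=
    congrArg Subtype.val (star_rangeSum X F)
  by_contra! hlt
  have h1 : Tendsto (fun n : ℕ => ‖(rangeSum X F : Compl X)‖ ^ (2 ^ n)) atTop atTop :=
    (tendsto_pow_atTop_atTop_of_one_lt hlt).comp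
      (tendsto_pow_atTop_atTop_of_one_lt (one_lt_two (α := ℕ)))
  obtain ⟨n, hn⟩ := (h1.eventually_gt_atTop (∑ ξ ∈ F, ‖(ξ : E)‖ * ‖(ξ : E)‖)).exists
  obtain ⟨m, hm⟩ := Nat.exists_eq_succ_of_ne_zero (pow_ne_zero n (two_ne_zero (α := ℕ)))
  rw [← hsa.norm_pow_two_pow, hm] at hn
  exact hn.not_ge (hb m)

theorem closure_range_coe (S : Set (Compl X)) (hS : IsClosed S)
    (h : ∀ x : Free X, (x : Compl X) ∈ S) (y : Compl X) : y ∈ S :=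
  UniformSpace.Completion.induction_on y hS h

theorem coe_gen_pi (a : A) : ((gen X (.pi a) : Free X) : Compl X) = piC X a := rfl

theorem coe_gen_t (ξ : E) : ((gen X (.t ξ) : Free X) : Compl X) = tC X ξ := rfl

theorem coe_gen_tAdj (ξ : E) : ((gen X (.tAdj ξ) : Free X) : Compl X) = star (tC X ξ) := by
  rw [← coe_gen_t, star_coe, star_gen]
  rfl

theorem coe_algebraMap_free (c : ℂ) :
    ((algebraMap ℂ (Free X) c : Free X) : Compl X) = c • 1 := by
  rw [Algebra.algebraMap_eq_smul_one, UniformSpace.Completion.coe_smul,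
    UniformSpace.Completion.coe_one]

variable {X} in
/-- The Cuntz-Toeplitz algebra is an ideal of the unital algebra that contains it. -/
theorem mul_mem_toeplitz (y : Compl X) :
    ∀ z ∈ toeplitz X, y * z ∈ toeplitz X := by
  have hcl := NonUnitalStarSubalgebra.isClosed_topologicalClosure
    (NonUnitalStarAlgebra.adjoin ℂ (generators X))
  refine closure_range_coe X {y | ∀ z ∈ toeplitz X, y * z ∈ toeplitz X} ?_ (fun x => ?_) y
  · simp only [Set.ofPred_forall]
    exact isClosed_biInter fun z _ => hcl.preimage (continuous_mul_const z)
  · rw [Set.mem_ofPred_eq]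
    induction x using free_induction with
    | h0 c =>
      intro z hz
      rw [coe_algebraMap_free, smul_mul_assoc, one_mul]
      exact (toeplitz X).smul_mem c hz
    | h1 g =>
      intro z hz
      refine mul_mem ?_ hz
      cases g with
      | pi a => exact (Pi X a).2
      | t ξ => exact (T X ξ).2
      | tAdj ξ => rw [coe_gen_tAdj]; exact star_mem (T X ξ).2
    | hm a b ha hb =>
      intro z hz
      rw [UniformSpace.Completion.coe_mul, mul_assoc]
      exact ha _ (hb z hz)
    | ha a b h1 h2 =>
      intro z hz
      rw [UniformSpace.Completion.coe_add, add_mul]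
      exact add_mem (h1 z hz) (h2 z hz)

/-! ### Words -/

/-- The words `T_{ξ₁} ⋯ T_{ξₙ} c T_{η_m}^* ⋯ T_{η₁}^*` with `c = 1` or `c = Π(a)`. The index is the
degree `n - m` for the gauge action. -/
def IsWord (d : ℤ) (y : Compl X) : Prop :=
  ∃ (L R : List E) (c : Compl X), (c = 1 ∨ ∃ a, c = piC X a) ∧ d = L.length - R.length ∧
    y = (L.map (tC X)).prod * c * star (R.map (tC X)).prod

variable {X}

theorem IsWord.one : IsWord X 0 1 := ⟨[], [], 1, .inl rfl, by simp, by simp⟩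

theorem IsWord.piC (a : A) : IsWord X 0 (piC X a) := ⟨[], [], _, .inr ⟨a, rfl⟩, by simp, by simp⟩

theorem IsWord.star {d : ℤ} {y : Compl X} (h : IsWord X d y) : IsWord X (-d) (star y) := by
  obtain ⟨L, R, c, hc, rfl, rfl⟩ := h
  refine ⟨R, L, _, ?_, by ring, by rw [star_mul, star_mul, star_star, mul_assoc]⟩
  rcases hc with rfl | ⟨a, rfl⟩
  · exact .inl (star_one _)
  · exact .inr ⟨Star.star a, (map_star _ _).symm⟩

theorem IsWord.tC_mul {d : ℤ} {y : Compl X} (h : IsWord X d y) (ξ : E) :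
    IsWord X (d + 1) (tC X ξ * y) := by
  obtain ⟨L, R, c, hc, rfl, rfl⟩ := h
  exact ⟨ξ :: L, R, c, hc, by push_cast [List.length_cons]; ring, by simp [mul_assoc]⟩

theorem IsWord.piC_mul {d : ℤ} {y : Compl X} (h : IsWord X d y) (a : A) :
    IsWord X d (CuntzToeplitz.piC X a * y) := by
  obtain ⟨L, R, c, hc, hd, rfl⟩ := h
  cases L with
  | nil =>
    refine ⟨[], R, CuntzToeplitz.piC X a * c, .inr ?_, hd, by simp [mul_assoc]⟩
    rcases hc with rfl | ⟨b, rfl⟩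
    · exact ⟨a, mul_one _⟩
    · exact ⟨a * b, (map_mul _ _ _).symm⟩
  | cons ξ L =>
    refine ⟨X.Φ a ξ :: L, R, c, hc, by simpa using hd, ?_⟩
    simp only [List.map_cons, List.prod_cons, ← piC_mul_tC, mul_assoc]

theorem IsWord.star_tC_mul {d : ℤ} {y : Compl X} (h : IsWord X d y) (ξ : E) :
    IsWord X (d - 1) (Star.star (tC X ξ) * y) := by
  obtain ⟨L, R, c, hc, rfl, rfl⟩ := h
  cases L with
  | nil =>
    rcases hc with rfl | ⟨a, rfl⟩
    · refine ⟨[], R ++ [ξ], 1, .inl rfl, ?_, by simp⟩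
      push_cast [List.length_append, List.length_cons, List.length_nil]; ring
    · refine ⟨[], R ++ [X.Φ (Star.star a) ξ], 1, .inl rfl, ?_,
        by simp [← star_tC_mul_piC, mul_assoc]⟩
      push_cast [List.length_append, List.length_cons, List.length_nil]; ring
  | cons η L =>
    have h1 : IsWord X ((η :: L).length - R.length - 1)
        ((L.map (tC X)).prod * c * Star.star (R.map (tC X)).prod) :=
      ⟨L, R, c, hc, by push_cast [List.length_cons]; ring, rfl⟩
    convert h1.piC_mul (ip A ξ η) using 1
    rw [← star_tC_mul_tC]
    simp only [List.map_cons, List.prod_cons, mul_assoc]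

theorem IsWord.mul_tC {d : ℤ} {y : Compl X} (h : IsWord X d y) (ξ : E) :
    IsWord X (d + 1) (y * tC X ξ) := by
  convert (h.star.star_tC_mul ξ).star using 1
  · ring
  · simp

theorem IsWord.mul_star_tC {d : ℤ} {y : Compl X} (h : IsWord X d y) (ξ : E) :
    IsWord X (d - 1) (y * Star.star (tC X ξ)) := by
  convert (h.star.tC_mul ξ).star using 1
  · ring
  · simp

theorem IsWord.mul_piC {d : ℤ} {y : Compl X} (h : IsWord X d y) (a : A) :
    IsWord X d (y * CuntzToeplitz.piC X a) := by
  convert (h.star.piC_mul (Star.star a)).star using 1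
  · ring
  · simp [← map_star]

/-- A word of degree zero is `1`, or some `Π(a)`, or `T_ξ x T_η^*` for a shorter word `x` of degree
zero. -/
theorem IsWord.zero_induction {P : Compl X → Prop} {y : Compl X} (h : IsWord X 0 y)
    (h1 : P 1) (hp : ∀ a, P (CuntzToeplitz.piC X a))
    (ht : ∀ x, IsWord X 0 x → P x → ∀ ξ η, P (tC X ξ * x * Star.star (tC X η))) : P y := by
  obtain ⟨L, R, c, hc, hd, rfl⟩ := h
  induction L generalizing R with
  | nil =>
    obtain rfl : R = [] := by simpa using hd
    rcases hc with rfl | ⟨a, rfl⟩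
    · simpa using h1
    · simpa using hp a
  | cons ξ L ih =>
    cases R with
    | nil => simp only [List.length_cons, List.length_nil] at hd; omega
    | cons η R =>
      have hd' : (0 : ℤ) = L.length - R.length := by
        simp only [List.length_cons] at hd; omega
      have := ht _ ⟨L, R, c, hc, hd', rfl⟩ (ih R hd') ξ η
      simpa [mul_assoc] using this

/-- The words span a dense subspace. -/
theorem mem_of_words (S : Submodule ℂ (Compl X)) (hS : IsClosed (S : Set (Compl X)))
    (h : ∀ d y, IsWord X d y → y ∈ S) (y : Compl X) : y ∈ S := by
  let W : Submodule ℂ (Compl X) := Submodule.span ℂ {y | ∃ d, IsWord X d y}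
  have hW : W ≤ S := Submodule.span_le.2 fun y ⟨d, hy⟩ => h d y hy
  have hg : ∀ u : Compl X, (∀ d y, IsWord X d y → ∃ d', IsWord X d' (u * y)) →
      ∀ w ∈ W, u * w ∈ W := fun u hu w hw => by
    induction hw using Submodule.span_induction with
    | mem y hy =>
      obtain ⟨d, hy⟩ := hy
      exact Submodule.subset_span (hu d y hy)
    | zero => rw [mul_zero]; exact W.zero_mem
    | add y z _ _ h1 h2 => rw [mul_add]; exact W.add_mem h1 h2
    | smul c y _ h1 => rw [mul_smul_comm]; exact W.smul_mem c h1
  have key : ∀ x : Free X, ∀ w ∈ W, (x : Compl X) * w ∈ W := fun x => by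
    induction x using free_induction with
    | h0 c =>
      intro w hw
      rw [coe_algebraMap_free, smul_mul_assoc, one_mul]
      exact W.smul_mem c hw
    | h1 g =>
      cases g with
      | pi a => exact hg _ fun d y hy => ⟨d, hy.piC_mul a⟩
      | t ξ => exact hg _ fun d y hy => ⟨_, hy.tC_mul ξ⟩
      | tAdj ξ => rw [coe_gen_tAdj]; exact hg _ fun d y hy => ⟨_, hy.star_tC_mul ξ⟩
    | hm a b ha hb =>
      intro w hw
      rw [UniformSpace.Completion.coe_mul, mul_assoc]
      exact ha _ (hb w hw)
    | ha a b h1 h2 =>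
      intro w hw
      rw [UniformSpace.Completion.coe_add, add_mul]
      exact W.add_mem (h1 w hw) (h2 w hw)
  refine closure_range_coe X (S : Set (Compl X)) hS (fun x => hW ?_) y
  simpa using key x 1 (Submodule.subset_span ⟨0, IsWord.one⟩)

end Words

/-! ### Positive functionals -/

section Positive

variable {B : Type*} [NonUnitalCStarAlgebra B] {ω : B →L[ℂ] ℂ}

theorem map_star_of_positive (h : ∀ x, 0 ≤ ω (star x * x)) (x : B) :
    ω (star x) = star (ω x) := by
  let : PartialOrder B := CStarAlgebra.spectralOrder B
  have : StarOrderedRing B := CStarAlgebra.spectralOrderedRing B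
  let f : B →ₚ[ℂ] ℂ := PositiveLinearMap.mk₀ ω.toLinearMap fun y hy => by
    obtain ⟨z, rfl⟩ := CStarAlgebra.nonneg_iff_eq_star_mul_self.1 hy
    exact h z
  exact map_star f x

theorem mono_of_positive [PartialOrder B] [StarOrderedRing B] (h : ∀ x, 0 ≤ ω (star x * x))
    {x y : B} (hxy : x ≤ y) : ω x ≤ ω y := by
  rw [← sub_nonneg] at hxy ⊢
  obtain ⟨z, hz⟩ := CStarAlgebra.nonneg_iff_eq_star_mul_self.1 hxy
  rw [← map_sub, hz]
  exact h z

theorem norm_sq_map_le (h : ∀ x, 0 ≤ ω (star x * x)) (x y : B) :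
    ‖ω (star x * y)‖ ^ 2 ≤ (ω (star x * x)).re * (ω (star y * y)).re := by
  let c : PreInnerProductSpace.Core ℂ B :=
    { inner := fun a b => ω (star a * b)
      conj_inner_symm := fun a b => by
        rw [starRingEnd_apply, ← map_star_of_positive h, star_mul, star_star]
      re_inner_nonneg := fun a => (RCLike.nonneg_iff.1 (h a)).1
      add_left := fun a b d => by rw [star_add, add_mul, map_add]
      smul_left := fun a b r => by
        rw [star_smul, smul_mul_assoc, map_smul, smul_eq_mul]; rfl }
  have h1 := InnerProductSpace.Core.inner_mul_inner_self_le (𝕜 := ℂ) (c := c) x y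
  have h2 : ‖ω (star y * x)‖ = ‖ω (star x * y)‖ := by
    rw [← norm_star, ← map_star_of_positive h, star_mul, star_star]
  change ‖ω (star x * y)‖ * ‖ω (star y * x)‖ ≤ _ at h1
  rw [h2, ← pow_two] at h1
  exact h1

theorem norm_map_conj_le (h : ∀ x, 0 ≤ ω (star x * x)) (t x : B) :
    ‖ω (star t * x * t)‖ ≤ ‖x‖ * (ω (star t * t)).re := by
  let : PartialOrder B := CStarAlgebra.spectralOrder B
  have : StarOrderedRing B := CStarAlgebra.spectralOrderedRing B
  have h0 : 0 ≤ (ω (star t * t)).re := (RCLike.nonneg_iff.1 (h t)).1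
  refine le_of_sq_le ?_ (by positivity)
  have h1 := norm_sq_map_le h t (x * t)
  have h2 : (ω (star (x * t) * (x * t))).re ≤ ‖x‖ ^ 2 * (ω (star t * t)).re := by
    have h3 : star (x * t) * (x * t) ≤ ‖star x * x‖ • (star t * t) := by
      rw [star_mul, mul_assoc, ← mul_assoc (star x), ← mul_assoc]
      exact CStarAlgebra.star_left_conjugate_le_norm_smul
    have h4 := (RCLike.le_iff_re_im.1 (mono_of_positive h h3)).1
    rw [CStarRing.norm_star_mul_self, ← Complex.coe_smul, map_smul] at h4
    simpa [pow_two] using h4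
  rw [mul_assoc]
  calc _ ≤ _ := h1
    _ ≤ (ω (star t * t)).re * (‖x‖ ^ 2 * (ω (star t * t)).re) := by gcongr
    _ = _ := by ring

/-- For a state `ω` and a selfadjoint contraction `p` on which `ω` is nearly `1`, the functionals
`ω` and `ω(p ·)` are close: with an approximate unit `e`, apply the Cauchy-Schwarz inequality to
`e (1 - p)` and `b`. -/
theorem IsState.norm_sq_map_sub_le (hω : IsState ω) {p : B} (hp : star p = p) (hp1 : ‖p‖ ≤ 1)
    (b : B) : ‖ω (b - p * b)‖ ^ 2 ≤ (2 - 2 * (ω p).re) * (ω (star b * b)).re := by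
  let : PartialOrder B := CStarAlgebra.spectralOrder B
  have : StarOrderedRing B := CStarAlgebra.spectralOrderedRing B
  have hl := CStarAlgebra.increasingApproximateUnit B
  have : (CStarAlgebra.approximateUnit B).NeBot := hl.neBot
  have hb : 0 ≤ (ω (star b * b)).re := (RCLike.nonneg_iff.1 (hω.nonneg b)).1
  have hle : ∀ x : B, ‖x‖ ≤ 1 → (ω x).re ≤ 1 := fun x hx =>
    (Complex.re_le_norm _).trans ((ω.le_opNorm x).trans (by rw [hω.norm_eq_one, one_mul]; exact hx))
  have h1 : Tendsto (fun e : B => ‖ω (e * (b - p * b))‖ ^ 2) (CStarAlgebra.approximateUnit B)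
      (𝓝 (‖ω (b - p * b)‖ ^ 2)) :=
    (((ω.continuous.tendsto _).comp (hl.tendsto_mul_right _)).norm).pow 2
  have h2 : Tendsto (fun e : B => e * p * e) (CStarAlgebra.approximateUnit B) (𝓝 p) := by
    have h3 : Tendsto (fun e : B => ‖p * e - p‖ + ‖e * p - p‖) (CStarAlgebra.approximateUnit B)
        (𝓝 0) := by
      simpa using (tendsto_iff_norm_sub_tendsto_zero.1 (hl.tendsto_mul_left p)).add
        (tendsto_iff_norm_sub_tendsto_zero.1 (hl.tendsto_mul_right p))
    rw [tendsto_iff_norm_sub_tendsto_zero]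
    refine squeeze_zero' (.of_forall fun e => norm_nonneg _) ?_ h3
    filter_upwards [hl.eventually_norm] with e hn
    have h4 : e * p * e - p = e * (p * e - p) + (e * p - p) := by noncomm_ring
    rw [h4]
    refine (norm_add_le _ _).trans (add_le_add_left ((norm_mul_le _ _).trans ?_) _)
    exact mul_le_of_le_one_left (norm_nonneg _) hn
  have h3 : Tendsto (fun e : B => (2 - 2 * (ω (e * p * e)).re) * (ω (star b * b)).re)
      (CStarAlgebra.approximateUnit B) (𝓝 ((2 - 2 * (ω p).re) * (ω (star b * b)).re)) :=
    ((tendsto_const_nhds.sub (((Complex.continuous_re.tendsto _).comp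
      ((ω.continuous.tendsto _).comp h2)).const_mul 2))).mul_const _
  refine le_of_tendsto_of_tendsto h1 h3 ?_
  filter_upwards [hl.eventually_star_eq, hl.eventually_norm] with e he hn
  have h4 := norm_sq_map_le hω.nonneg (e - p * e) b
  have h5 : star (e - p * e) * b = e * (b - p * b) := by
    rw [star_sub, star_mul, he, hp]; noncomm_ring
  have h6 : (ω (star (e - p * e) * (e - p * e))).re ≤ 2 - 2 * (ω (e * p * e)).re := by
    have h7 : star (e - p * e) * (e - p * e) =
        e * e - e * p * e - e * p * e + e * p * (p * e) := by
      rw [star_sub, star_mul, he, hp]; noncomm_ring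
    have h8 : ‖e * e‖ ≤ 1 := (norm_mul_le _ _).trans (mul_le_one₀ hn (norm_nonneg _) hn)
    have h9 : ‖p * e‖ ≤ 1 := (norm_mul_le _ _).trans (mul_le_one₀ hp1 (norm_nonneg _) hn)
    have h9' : ‖e * p‖ ≤ 1 := (norm_mul_le _ _).trans (mul_le_one₀ hn (norm_nonneg _) hp1)
    have h10 : ‖e * p * (p * e)‖ ≤ 1 := (norm_mul_le _ _).trans (mul_le_one₀ h9' (norm_nonneg _) h9)
    rw [h7]
    simp only [map_add, map_sub, Complex.add_re, Complex.sub_re]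
    linarith [hle _ h8, hle _ h10]
  rw [h5] at h4
  exact h4.trans (mul_le_mul_of_nonneg_right h6 hb)

variable {ι : Type*} {l : Filter ι} {P : ι → B}

theorem IsState.tendsto_map_mul_left (hω : IsState ω) (hP : ∀ i, star (P i) = P i)
    (hP1 : ∀ i, ‖P i‖ ≤ 1) (h : Tendsto (fun i => ω (P i)) l (𝓝 1)) (b : B) :
    Tendsto (fun i => ω (P i * b)) l (𝓝 (ω b)) := by
  have h1 : Tendsto (fun i => (2 - 2 * (ω (P i)).re) * (ω (star b * b)).re) l (𝓝 0) := by
    simpa using ((tendsto_const_nhds (x := (2 : ℝ))).sub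
      (((Complex.continuous_re.tendsto _).comp h).const_mul
      2)).mul_const (ω (star b * b)).re
  have h2 := squeeze_zero (fun i => by positivity)
    (fun i => hω.norm_sq_map_sub_le (hP i) (hP1 i) b) h1
  have h3 : Tendsto (fun i => ‖ω (b - P i * b)‖) l (𝓝 0) := by simpa using h2.sqrt
  rw [tendsto_iff_norm_sub_tendsto_zero]
  simpa only [norm_sub_rev, map_sub] using h3

theorem IsState.tendsto_map_mul_right (hω : IsState ω) (hP : ∀ i, star (P i) = P i)
    (hP1 : ∀ i, ‖P i‖ ≤ 1) (h : Tendsto (fun i => ω (P i)) l (𝓝 1)) (b : B) :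
    Tendsto (fun i => ω (b * P i)) l (𝓝 (ω b)) := by
  have h1 := (continuous_star.tendsto _).comp (hω.tendsto_map_mul_left hP hP1 h (star b))
  simp only [Function.comp_def, ← map_star_of_positive hω.nonneg, star_mul, star_star, hP] at h1
  exact h1

end Positive

/-! ### The gauge action on words, and KMS states of infinite type -/

section KMS

variable {A E : Type*} [NonUnitalCStarAlgebra A] [PartialOrder A] [StarOrderedRing A]
  [NormedAddCommGroup E] [NormedSpace ℂ E] [SMul Aᵐᵒᵖ E] [CStarModule Aᵐᵒᵖ E]
  {X : Correspondence A E} {Λ : Set E} {β : ℝ}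

theorem gaugeCompl_piC (z : Circle) (a : A) : gaugeCompl X z (piC X a) = piC X a := by
  rw [← coe_gen_pi, gaugeCompl_coe, gaugeFree_gen]
  rfl

theorem gaugeCompl_tC (z : Circle) (ξ : E) : gaugeCompl X z (tC X ξ) = (z : ℂ) • tC X ξ := by
  rw [← coe_gen_t, gaugeCompl_coe, gaugeFree_gen]
  exact UniformSpace.Completion.coe_smul _ _

theorem gaugeCompl_list (z : Circle) (L : List E) :
    gaugeCompl X z (L.map (tC X)).prod = ((z : ℂ) ^ L.length) • (L.map (tC X)).prod := by
  induction L with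
  | nil => simp
  | cons ξ L ih =>
    rw [List.map_cons, List.prod_cons, map_mul, ih, gaugeCompl_tC, smul_mul_smul_comm,
      List.length_cons, pow_succ']

theorem IsWord.gaugeCompl {d : ℤ} {y : Compl X} (h : IsWord X d y) (z : Circle) :
    gaugeCompl X z y = ((z : ℂ) ^ d) • y := by
  obtain ⟨L, R, c, hc, rfl, rfl⟩ := h
  have h1 : CuntzToeplitz.gaugeCompl X z c = c := by
    rcases hc with rfl | ⟨a, rfl⟩
    · exact map_one _
    · exact gaugeCompl_piC z a
  rw [map_mul, map_mul, map_star, gaugeCompl_list, gaugeCompl_list, h1, star_smul, smul_mul_assoc,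
    smul_mul_smul_comm, zpow_sub₀ (Circle.coe_ne_zero z), zpow_natCast, zpow_natCast, star_pow,
    div_eq_mul_inv, ← inv_pow, ← Circle.coe_inv, Circle.coe_inv_eq_conj]
  rfl

theorem coe_gauge (s : ℝ) (y : Toeplitz X) :
    ((gauge X s y : Toeplitz X) : Compl X) = gaugeCompl X (Circle.exp s) y := rfl

theorem gauge_of_isWord {d : ℤ} {y : Toeplitz X} (h : IsWord X d (y : Compl X)) (s : ℝ) :
    gauge X s y = Complex.exp (d * s * Complex.I) • y := Subtype.ext <| by
  rw [coe_gauge, h.gaugeCompl, Circle.coe_exp, ← Complex.exp_int_mul, mul_assoc]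
  rfl

theorem isWord_T (ξ : E) : IsWord X 1 (T X ξ : Compl X) := by
  simpa [coe_T] using (IsWord.one (X := X)).tC_mul ξ

theorem isWord_Pi (a : A) : IsWord X 0 (Pi X a : Compl X) := IsWord.piC a

theorem IsWord.mem_toeplitz {d : ℤ} (hd : d ≠ 0) {y : Compl X} (h : IsWord X d y) :
    y ∈ toeplitz X := by
  have key : ∀ (R : List E) (u : Compl X), R ≠ [] →
      u * Star.star (R.map (tC X)).prod ∈ toeplitz X := by
    intro R u hR
    obtain ⟨η, R, rfl⟩ := List.exists_cons_of_ne_nil hR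
    rw [List.map_cons, List.prod_cons, star_mul, ← mul_assoc]
    exact mul_mem_toeplitz _ _ (star_mem (T X η).2)
  obtain ⟨L, R, c, hc, rfl, rfl⟩ := h
  by_cases hR : R = []
  · have hL : L ≠ [] := by
      rintro rfl
      simp [hR] at hd
    have := star_mem (key L (Star.star (c * Star.star (R.map (tC X)).prod)) hL)
    rwa [star_mul, star_star, star_star, ← mul_assoc] at this
  · exact key R _ hR

/-- The KMS condition for a homogeneous element. -/
theorem IsKMSState.map_mul_of_isWord {ω : Toeplitz X →L[ℂ] ℂ} (h : IsKMSState (gauge X) β ω)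
    {d : ℤ} {y : Toeplitz X} (hy : IsWord X d (y : Compl X)) (x : Toeplitz X) :
    Complex.exp (-(d * β)) * ω (x * y) = ω (y * x) := by
  have h1 := h.kms x y (fun z => Complex.exp (d * z * Complex.I) • y)
    (by fun_prop) (fun s => (gauge_of_isWord hy s).symm)
  rw [← h1, mul_smul_comm, map_smul, smul_eq_mul]
  congr 2
  linear_combination -(d * β : ℂ) * Complex.I_mul_I

theorem tendsto_map_rangeSum {ω : Toeplitz X →L[ℂ] ℂ} (h : ω ∈ infiniteKMS X Λ β) :
    Tendsto (fun F : Finset Λ => ω (rangeSum X F)) atTop (𝓝 1) := by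
  refine Tendsto.congr (fun F => ?_) h.2
  rw [rangeSum, map_sum]

theorem restriction_apply (ω : Toeplitz X →L[ℂ] ℂ) (a : A) : restriction X ω a = ω (Pi X a) := rfl

theorem restriction_mem (hΛ : IsFrame A Λ) {ω : Toeplitz X →L[ℂ] ℂ} (h : ω ∈ infiniteKMS X Λ β) :
    restriction X ω ∈ scalingTraces X Λ β := by
  have hT : ∀ (ξ : E) (x : Toeplitz X), (Real.exp (-β) : ℂ) * ω (x * T X ξ) = ω (T X ξ * x) :=
    fun ξ x => by simpa using h.1.map_mul_of_isWord (isWord_T ξ) x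
  refine ⟨⟨fun a => ?_, fun a b => ?_⟩, ?_, fun a => ?_⟩
  · rw [restriction_apply, map_mul, map_star]
    exact h.1.isState.nonneg _
  · rw [restriction_apply, restriction_apply, map_mul (Pi X), map_mul (Pi X)]
    simpa using h.1.map_mul_of_isWord (isWord_Pi b) (Pi X a)
  · refine h.2.congr_fun fun ξ => ?_
    rw [restriction_apply, ← star_T_mul_T, hT]
  · have h1 := h.1.isState.tendsto_map_mul_left (star_rangeSum X) (norm_rangeSum_le X hΛ)
      (tendsto_map_rangeSum h) (Pi X a)
    refine Tendsto.congr (fun F => ?_) h1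
    rw [rangeSum, Finset.sum_mul, map_sum]
    refine Finset.sum_congr rfl fun ξ _ => ?_
    change _ = (Real.exp (-β) : ℂ) * ω (Pi X (ip A (ξ : E) (X.Φ a (ξ : E))))
    rw [← star_T_mul_T, ← Pi_mul_T, ← mul_assoc, hT, mul_assoc]

theorem convex_infiniteKMS (hΛ : IsFrame A Λ) : Convex ℝ (infiniteKMS X Λ β) := by
  intro ω₁ h₁ ω₂ h₂ s t hs ht hst
  have hst' : (s : ℂ) + t = 1 := by exact_mod_cast hst
  have happ : ∀ y, (s • ω₁ + t • ω₂) y = (s : ℂ) * ω₁ y + (t : ℂ) * ω₂ y := fun y => by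
    rw [add_apply, smul_apply, smul_apply, Complex.real_smul, Complex.real_smul]
  have hsum : HasSum (fun ξ : Λ => (s • ω₁ + t • ω₂) (T X (ξ : E) * star (T X (ξ : E)))) 1 := by
    simp only [happ]
    simpa [hst'] using (h₁.2.mul_left (s : ℂ)).add (h₂.2.mul_left (t : ℂ))
  refine ⟨⟨⟨fun y => ?_, le_antisymm ?_ ?_⟩, fun x y f hf hfs => ?_⟩, hsum⟩
  · rw [happ]
    exact add_nonneg (mul_nonneg (by exact_mod_cast hs) (h₁.1.isState.nonneg y))
      (mul_nonneg (by exact_mod_cast ht) (h₂.1.isState.nonneg y))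
  · refine (norm_add_le _ _).trans ?_
    rw [norm_smul, norm_smul, h₁.1.isState.norm_eq_one, h₂.1.isState.norm_eq_one,
      Real.norm_of_nonneg hs, Real.norm_of_nonneg ht, mul_one, mul_one, hst]
  · have h1 : Tendsto (fun F : Finset Λ => ‖(s • ω₁ + t • ω₂) (rangeSum X F)‖) atTop (𝓝 1) := by
      rw [← norm_one (α := ℂ)]
      refine Tendsto.norm (Tendsto.congr (fun F => ?_) hsum)
      rw [rangeSum, map_sum]
    refine le_of_tendsto h1 (.of_forall fun F => ?_)
    exact (ContinuousLinearMap.le_opNorm _ _).trans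
      (mul_le_of_le_one_right (norm_nonneg _) (norm_rangeSum_le X hΛ F))
  · rw [happ, happ, h₁.1.kms x y f hf hfs, h₂.1.kms x y f hf hfs]

theorem convex_scalingTraces : Convex ℝ (scalingTraces X Λ β) := by
  intro τ₁ h₁ τ₂ h₂ s t hs ht hst
  have hst' : (s : ℂ) + t = 1 := by exact_mod_cast hst
  have happ : ∀ a, (s • τ₁ + t • τ₂) a = (s : ℂ) * τ₁ a + (t : ℂ) * τ₂ a := fun y => by
    rw [add_apply, smul_apply, smul_apply, Complex.real_smul, Complex.real_smul]
  refine ⟨⟨fun a => ?_, fun a b => ?_⟩, ?_, fun a => ?_⟩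
  · rw [happ]
    exact add_nonneg (mul_nonneg (by exact_mod_cast hs) (h₁.1.nonneg a))
      (mul_nonneg (by exact_mod_cast ht) (h₂.1.nonneg a))
  · rw [happ, happ, h₁.1.tracial, h₂.1.tracial]
  · simp only [happ, mul_add, mul_left_comm (Real.exp (-β) : ℂ)]
    simpa [hst'] using (h₁.2.1.mul_left (s : ℂ)).add (h₂.2.1.mul_left (t : ℂ))
  · simp only [happ, mul_add, mul_left_comm (Real.exp (-β) : ℂ)]
    exact ((h₁.2.2 a).mul_left (s : ℂ)).add ((h₂.2.2 a).mul_left (t : ℂ))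

/-! ### A KMS state of infinite type is determined by its restriction -/

/-- For `β ≠ 0` a KMS state of infinite type vanishes on the words of nonzero degree, as
`e^{-dβ} ω(y) = ω(y)` for a word `y` of degree `d`. -/
theorem map_eq_zero_of_isWord (hΛ : IsFrame A Λ) (hβ : β ≠ 0) {ω : Toeplitz X →L[ℂ] ℂ}
    (h : ω ∈ infiniteKMS X Λ β) {d : ℤ} (hd : d ≠ 0) {y : Toeplitz X}
    (hy : IsWord X d (y : Compl X)) : ω y = 0 := by
  have h1 := h.1.isState.tendsto_map_mul_left (star_rangeSum X) (norm_rangeSum_le X hΛ)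
      (tendsto_map_rangeSum h) y
  have h2 := h.1.isState.tendsto_map_mul_right (star_rangeSum X) (norm_rangeSum_le X hΛ)
      (tendsto_map_rangeSum h) y
  have h3 : Complex.exp (-(d * β)) * ω y = ω y := by
    refine tendsto_nhds_unique ((h1.const_mul _).congr fun F => ?_) h2
    exact h.1.map_mul_of_isWord hy _
  by_contra h0
  have h4 := mul_right_cancel₀ h0 (h3.trans (one_mul _).symm)
  have h5 : Real.exp (-(d * β)) = 1 := by exact_mod_cast h4
  rw [Real.exp_eq_one_iff, neg_eq_zero, mul_eq_zero] at h5
  rcases h5 with h5 | h5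
  · exact hd (by exact_mod_cast h5)
  · exact hβ h5

/-- The difference `D` of two such states with the same restriction, extended to `Compl X`, vanishes
on the words of nonzero degree. As `D (T_ξ x T_η^*) = e^{-β} D (x Π(⟨η, ξ⟩))`, it also vanishes on
the elements `y Π(a)`, thus on all `y T_ζ T_ζ^*`, which is enough by infinite type. -/
theorem injOn_restriction (hΛ : IsFrame A Λ) (hβ : β ≠ 0) :
    Set.InjOn (restriction X) (infiniteKMS X Λ β) := by
  intro ω₁ h₁ ω₂ h₂ h12
  -- the recursion leads through elements such as `1`, which lie outside `𝒯_E`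
  obtain ⟨D, hD, -⟩ := exists_extension_norm_eq (toeplitz X).toSubmodule
    (show (toeplitz X).toSubmodule →L[ℂ] ℂ from ω₁ - ω₂)
  have hD' : ∀ z : Toeplitz X, D z = ω₁ z - ω₂ z := hD
  have hword : ∀ d y, d ≠ 0 → IsWord X d y → D y = 0 := fun d y hd hy => by
    have := hD' ⟨y, hy.mem_toeplitz hd⟩
    rw [map_eq_zero_of_isWord hΛ hβ h₁ hd hy, map_eq_zero_of_isWord hΛ hβ h₂ hd hy,
      sub_zero] at this
    exact this
  have hpi : ∀ a, D (piC X a) = 0 := fun a => by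
    rw [← coe_Pi, hD', sub_eq_zero]
    exact congrArg (fun f => f a) h12
  have hT : ∀ (ξ η : E) (x : Compl X), D (tC X ξ * x * star (tC X η)) =
      (Real.exp (-β) : ℂ) * D (x * piC X (ip A η ξ)) := fun ξ η x => by
    have hx : x * star (tC X η) ∈ toeplitz X := mul_mem_toeplitz _ _ (star_mem (T X η).2)
    have hk : ∀ ω ∈ infiniteKMS X Λ β, (Real.exp (-β) : ℂ) * ω (⟨_, hx⟩ * T X ξ) =
        ω (T X ξ * ⟨_, hx⟩) :=
      fun ω h => by simpa using h.1.map_mul_of_isWord (isWord_T ξ) ⟨_, hx⟩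
    rw [mul_assoc, ← star_tC_mul_tC, ← mul_assoc x]
    have e1 := hD' (T X ξ * ⟨_, hx⟩)
    have e2 := hD' (⟨_, hx⟩ * T X ξ)
    rw [← hk ω₁ h₁, ← hk ω₂ h₂, ← mul_sub, ← e2] at e1
    exact e1
  have htt : ∀ ξ η, D (tC X ξ * star (tC X η)) = 0 := fun ξ η => by
    simpa [hpi] using hT ξ η 1
  have hmul : ∀ d y, IsWord X d y → ∀ a, D (y * piC X a) = 0 := fun d y hy => by
    by_cases hd : d = 0
    · subst hd
      refine IsWord.zero_induction (P := fun y => ∀ a, D (y * piC X a) = 0) hy ?_ ?_ ?_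
      · intro a; rw [one_mul, hpi]
      · intro b a; rw [← map_mul, hpi]
      · intro x _ ih ξ η a
        rw [mul_assoc, star_tC_mul_piC, hT, ih, mul_zero]
    · exact fun a => hword d _ hd (hy.mul_piC a)
  have hTT : ∀ (ζ : E) (y : Compl X), D (y * (tC X ζ * star (tC X ζ))) = 0 := fun ζ => by
    let S : Submodule ℂ (Compl X) := LinearMap.ker
      (D.comp ((ContinuousLinearMap.mul ℂ (Compl X)).flip (tC X ζ * star (tC X ζ)))).toLinearMap
    have hS : IsClosed (S : Set (Compl X)) := ContinuousLinearMap.isClosed_ker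
      (D.comp ((ContinuousLinearMap.mul ℂ (Compl X)).flip (tC X ζ * star (tC X ζ))))
    refine fun y => mem_of_words S hS (fun d y hy => ?_) y
    change D (y * (tC X ζ * star (tC X ζ))) = 0
    by_cases hd : d = 0
    · subst hd
      refine IsWord.zero_induction (P := fun y => D (y * (tC X ζ * star (tC X ζ))) = 0) hy ?_ ?_ ?_
      · rw [one_mul, htt]
      · intro b
        rw [← mul_assoc, piC_mul_tC, htt]
      · intro x hx _ ξ η
        have : tC X ξ * x * star (tC X η) * (tC X ζ * star (tC X ζ)) =
            tC X ξ * (x * piC X (ip A η ζ)) * star (tC X ζ) := by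
          rw [← star_tC_mul_tC]; simp only [mul_assoc]
        rw [this, hT, hmul 0 _ (hx.mul_piC _), mul_zero]
    · rw [← mul_assoc]
      exact hword _ _ hd (by simpa using (hy.mul_tC ζ).mul_star_tC ζ)
  ext z
  rw [← sub_eq_zero]
  have h3 := (h₁.1.isState.tendsto_map_mul_right (star_rangeSum X) (norm_rangeSum_le X hΛ)
      (tendsto_map_rangeSum h₁) z).sub (h₂.1.isState.tendsto_map_mul_right (star_rangeSum X)
      (norm_rangeSum_le X hΛ) (tendsto_map_rangeSum h₂) z)
  refine tendsto_nhds_unique h3 (tendsto_const_nhds.congr fun F => ?_)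
  rw [← hD']
  change 0 = D ((z : Compl X) * (rangeSum X F : Compl X))
  rw [coe_rangeSum, Finset.mul_sum, map_sum]
  exact (Finset.sum_eq_zero fun ξ _ => hTT _ _).symm

end KMS

/-! ### Seminorms from representations on semi-inner product spaces -/

section Rep

open scoped InnerProductSpace

variable {A V : Type*} [NonUnitalCStarAlgebra A] [SeminormedAddCommGroup V] [InnerProductSpace ℂ V]

theorem norm_clm_eq_zero {S : V →L[ℂ] V} (h : ∀ u v, ⟪u, S v⟫_ℂ = 0) : ‖S‖ = 0 := by
  refine le_antisymm (S.opNorm_le_bound le_rfl fun v => ?_) (norm_nonneg _)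
  have h1 := h (S v) v
  rw [inner_self_eq_norm_sq_to_K] at h1
  have h2 : ‖S v‖ = 0 := by simpa using h1
  rw [h2, zero_mul]

/-- A family of linear maps that is a `*`-representation of a `C*`-algebra up to vectors of length
zero is contractive. -/
theorem norm_rep_le {π : A → V →ₗ[ℂ] V}
    (hadd : ∀ a b u v, ⟪u, π (a + b) v⟫_ℂ = ⟪u, π a v⟫_ℂ + ⟪u, π b v⟫_ℂ)
    (hsmul : ∀ (c : ℂ) a u v, ⟪u, π (c • a) v⟫_ℂ = c * ⟪u, π a v⟫_ℂ)
    (hmul : ∀ a b u v, ⟪u, π (a * b) v⟫_ℂ = ⟪u, π a (π b v)⟫_ℂ)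
    (hadj : ∀ a u v, ⟪π a u, v⟫_ℂ = ⟪u, π (star a) v⟫_ℂ) (a : A) (v : V) :
    ‖π a v‖ ≤ ‖a‖ * ‖v‖ := by
  obtain ⟨c, b, hc, hb⟩ := exists_scalar_add_sqrt a
  have h1 : ⟪v, π (star c • b + c • star b + star b * b) v⟫_ℂ = - ⟪π a v, π a v⟫_ℂ := by
    rw [hb, ← neg_one_smul ℂ, hsmul, hmul, hadj, neg_one_mul]
  rw [hadd, hadd, hsmul, hsmul, hmul] at h1
  have h2 : ⟪c • v + π b v, c • v + π b v⟫_ℂ =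
      ((‖a‖ ^ 2 : ℝ) : ℂ) * ⟪v, v⟫_ℂ - ⟪π a v, π a v⟫_ℂ := by
    rw [sub_eq_add_neg, ← h1, ← hc]
    simp only [inner_add_left, inner_add_right, inner_smul_left, inner_smul_right, hadj,
      starRingEnd_apply]
    ring
  have h3 := (inner_self_nonneg (𝕜 := ℂ) (x := c • v + π b v))
  rw [h2, inner_self_eq_norm_sq_to_K, inner_self_eq_norm_sq_to_K] at h3
  refine le_of_sq_le ?_ (by positivity)
  have h4 : (0 : ℝ) ≤ ‖a‖ ^ 2 * ‖v‖ ^ 2 - ‖π a v‖ ^ 2 := by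
    have h5 : ((‖a‖ ^ 2 : ℝ) : ℂ) * (‖v‖ : ℂ) ^ 2 - (‖π a v‖ : ℂ) ^ 2 =
        ((‖a‖ ^ 2 * ‖v‖ ^ 2 - ‖π a v‖ ^ 2 : ℝ) : ℂ) := by push_cast; ring
    exact h3.trans_eq (congrArg Complex.re h5)
  rw [mul_pow]
  linarith

end Rep

section PreRep

open scoped InnerProductSpace

variable {A E : Type*} [NonUnitalCStarAlgebra A] [PartialOrder A] [StarOrderedRing A]
  [NormedAddCommGroup E] [NormedSpace ℂ E] [SMul Aᵐᵒᵖ E] [CStarModule Aᵐᵒᵖ E]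
  {X : Correspondence A E} {V : Type*} [SeminormedAddCommGroup V] [InnerProductSpace ℂ V]

variable (X V) in
/-- A representation of the correspondence on a semi-inner product space by linear maps `π(a)`,
`t_ξ`, `t_ξ^*`. The maps `π(a)` need to depend linearly on `a` only up to vectors of length zero. -/
structure PreRep where
  pi : A → V →ₗ[ℂ] V
  t : E → V →ₗ[ℂ] V
  tAdj : E → V →ₗ[ℂ] V
  inner_pi_add : ∀ a b u v, ⟪u, pi (a + b) v⟫_ℂ = ⟪u, pi a v⟫_ℂ + ⟪u, pi b v⟫_ℂ
  inner_pi_smul : ∀ (c : ℂ) a u v, ⟪u, pi (c • a) v⟫_ℂ = c * ⟪u, pi a v⟫_ℂ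
  pi_mul : ∀ a b v, pi (a * b) v = pi a (pi b v)
  pi_t : ∀ a ξ v, pi a (t ξ v) = t (X.Φ a ξ) v
  tAdj_t : ∀ ξ η v, tAdj ξ (t η v) = pi (ip A ξ η) v
  adj_pi : ∀ a u v, ⟪pi a u, v⟫_ℂ = ⟪u, pi (star a) v⟫_ℂ
  adj_t : ∀ ξ u v, ⟪t ξ u, v⟫_ℂ = ⟪u, tAdj ξ v⟫_ℂ

namespace PreRep

variable (r : PreRep X V)

theorem adj_tAdj (ξ : E) (u v : V) : ⟪r.tAdj ξ u, v⟫_ℂ = ⟪u, r.t ξ v⟫_ℂ := by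
  rw [← inner_conj_symm, ← r.adj_t, inner_conj_symm]

theorem norm_pi_le (a : A) (v : V) : ‖r.pi a v‖ ≤ ‖a‖ * ‖v‖ :=
  norm_rep_le r.inner_pi_add r.inner_pi_smul (fun a b u v => by rw [r.pi_mul]) r.adj_pi a v

theorem norm_t_le (ξ : E) (v : V) : ‖r.t ξ v‖ ≤ ‖ξ‖ * ‖v‖ := by
  refine le_of_sq_le ?_ (by positivity)
  have h : ((‖r.t ξ v‖ ^ 2 : ℝ) : ℂ) = ⟪v, r.pi (ip A ξ ξ) v⟫_ℂ := by
    rw [← r.tAdj_t, ← r.adj_t, inner_self_eq_norm_sq_to_K]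
    norm_cast
  have h1 := congrArg (fun z : ℂ => ‖z‖) h
  simp only [Complex.norm_real, Real.norm_of_nonneg (sq_nonneg ‖r.t ξ v‖)] at h1
  rw [h1, mul_pow, norm_sq_eq_norm_ip (A := A)]
  calc _ ≤ ‖v‖ * (‖ip A ξ ξ‖ * ‖v‖) := (norm_inner_le_norm _ _).trans
        (mul_le_mul_of_nonneg_left (r.norm_pi_le _ _) (norm_nonneg _))
    _ = _ := by ring

theorem norm_tAdj_le (ξ : E) (v : V) : ‖r.tAdj ξ v‖ ≤ ‖ξ‖ * ‖v‖ := by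
  have h : ((‖r.tAdj ξ v‖ ^ 2 : ℝ) : ℂ) = ⟪r.t ξ (r.tAdj ξ v), v⟫_ℂ := by
    rw [r.adj_t, inner_self_eq_norm_sq_to_K]
    norm_cast
  have h1 := congrArg (fun z : ℂ => ‖z‖) h
  simp only [Complex.norm_real, Real.norm_of_nonneg (sq_nonneg ‖r.tAdj ξ v‖)] at h1
  have h2 : ‖r.tAdj ξ v‖ ^ 2 ≤ (‖ξ‖ * ‖v‖) * ‖r.tAdj ξ v‖ := by
    rw [h1]
    calc _ ≤ (‖ξ‖ * ‖r.tAdj ξ v‖) * ‖v‖ := (norm_inner_le_norm _ _).trans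
          (mul_le_mul_of_nonneg_right (r.norm_t_le _ _) (norm_nonneg _))
      _ = _ := by ring
  rcases (norm_nonneg (r.tAdj ξ v)).eq_or_lt with h0 | h0
  · rw [← h0]; positivity
  · rw [pow_two] at h2
    exact le_of_mul_le_mul_right h2 h0

/-- The bounded operator that represents a symbol. -/
def genL : Gen A E → V →L[ℂ] V
  | .pi a => (r.pi a).mkContinuous ‖a‖ (r.norm_pi_le a)
  | .t ξ => (r.t ξ).mkContinuous ‖ξ‖ (r.norm_t_le ξ)
  | .tAdj ξ => (r.tAdj ξ).mkContinuous ‖ξ‖ (r.norm_tAdj_le ξ)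

/-- The representation of the free algebra. -/
def rho : Free X →ₐ[ℂ] (V →L[ℂ] V) := FreeAlgebra.lift ℂ (A := V →L[ℂ] V) r.genL

theorem rho_gen (g : Gen A E) : r.rho (gen X g) = r.genL g :=
  FreeAlgebra.lift_ι_apply (A := V →L[ℂ] V) r.genL g

theorem rho_pi (a : A) (v : V) : r.rho (gen X (.pi a)) v = r.pi a v := by rw [rho_gen]; rfl

theorem rho_t (ξ : E) (v : V) : r.rho (gen X (.t ξ)) v = r.t ξ v := by rw [rho_gen]; rfl

theorem rho_tAdj (ξ : E) (v : V) : r.rho (gen X (.tAdj ξ)) v = r.tAdj ξ v := by rw [rho_gen]; rfl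

theorem inner_rho_star (x : Free X) : ∀ u v : V, ⟪r.rho (star x) u, v⟫_ℂ = ⟪u, r.rho x v⟫_ℂ := by
  induction x using free_induction with
  | h0 c =>
    intro u v
    rw [star_algebraMap_free, AlgHom.commutes, AlgHom.commutes, Algebra.algebraMap_eq_smul_one,
      Algebra.algebraMap_eq_smul_one]
    simp [inner_smul_left, inner_smul_right]
  | h1 g =>
    intro u v
    rw [star_gen]
    cases g with
    | pi a => simp only [Gen.adj, rho_pi, r.adj_pi, star_star]
    | t ξ => simp only [Gen.adj, rho_t, rho_tAdj, r.adj_tAdj]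
    | tAdj ξ => simp only [Gen.adj, rho_t, rho_tAdj, r.adj_t]
  | hm a b ha hb =>
    intro u v
    rw [star_mul, map_mul, map_mul, mul_apply_eq_comp, mul_apply_eq_comp, hb, ha]
  | ha a b ha hb =>
    intro u v
    rw [star_add, map_add, map_add, add_apply, add_apply, inner_add_left, inner_add_right, ha, hb]

theorem norm_rho_sq_le (x : Free X) : ‖r.rho x‖ ^ 2 ≤ ‖r.rho (star x * x)‖ := by
  have h : ‖r.rho x‖ ≤ √‖r.rho (star x * x)‖ := by
    refine ContinuousLinearMap.opNorm_le_bound _ (Real.sqrt_nonneg _) fun v => ?_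
    refine le_of_sq_le ?_ (by positivity)
    rw [mul_pow, Real.sq_sqrt (norm_nonneg _)]
    have h1 : ((‖r.rho x v‖ ^ 2 : ℝ) : ℂ) = ⟪v, r.rho (star x * x) v⟫_ℂ := by
      rw [map_mul, mul_apply_eq_comp, ← r.inner_rho_star, star_star, inner_self_eq_norm_sq_to_K]
      norm_cast
    have h2 := congrArg (fun z : ℂ => ‖z‖) h1
    simp only [Complex.norm_real, Real.norm_of_nonneg (sq_nonneg ‖r.rho x v‖)] at h2
    rw [h2]
    calc _ ≤ ‖v‖ * (‖r.rho (star x * x)‖ * ‖v‖) := (norm_inner_le_norm _ _).trans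
          (mul_le_mul_of_nonneg_left (ContinuousLinearMap.le_opNorm _ _) (norm_nonneg _))
      _ = _ := by ring
  calc _ ≤ √‖r.rho (star x * x)‖ ^ 2 := by gcongr
    _ = _ := Real.sq_sqrt (norm_nonneg _)

theorem norm_rho_star_le (x : Free X) : ‖r.rho (star x)‖ ≤ ‖r.rho x‖ := by
  have h := r.norm_rho_sq_le (star x)
  rw [star_star, map_mul] at h
  have h1 := h.trans (norm_mul_le _ _)
  rcases (norm_nonneg (r.rho (star x))).eq_or_lt with h0 | h0
  · rw [← h0]; exact norm_nonneg _
  · rw [pow_two] at h1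
    exact le_of_mul_le_mul_right h1 h0

/-- The operator seminorm is one of the seminorms that define the universal norm. -/
def toeplitzSeminorm : ToeplitzSeminorm X where
  toFun x := ‖r.rho x‖
  map_zero' := by rw [map_zero, norm_zero]
  add_le' x y := by rw [map_add]; exact norm_add_le _ _
  neg' x := by rw [map_neg, norm_neg]
  mul_le' x y := by rw [map_mul]; exact norm_mul_le _ _
  smul_eq c x := by rw [map_smul, norm_smul]
  cstar x := by
    refine le_antisymm ?_ (r.norm_rho_sq_le x)
    rw [map_mul, pow_two]
    exact (norm_mul_le _ _).trans
      (mul_le_mul_of_nonneg_right (r.norm_rho_star_le x) (norm_nonneg _))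
  pi_le a := by
    rw [rho_gen]
    exact LinearMap.mkContinuous_norm_le _ (norm_nonneg _) (r.norm_pi_le a)
  pi_add a b := norm_clm_eq_zero fun u v => by
    rw [map_sub, map_add, sub_apply, add_apply, rho_pi, rho_pi, rho_pi, inner_sub_right,
      inner_add_right, r.inner_pi_add, sub_self]
  pi_smul c a := norm_clm_eq_zero fun u v => by
    rw [map_sub, map_smul, sub_apply, smul_apply, rho_pi, rho_pi, inner_sub_right,
      inner_smul_right, r.inner_pi_smul, sub_self]
  pi_mul a b := norm_clm_eq_zero fun u v => by
    rw [map_sub, map_mul, sub_apply, mul_apply_eq_comp, rho_pi, rho_pi, rho_pi, r.pi_mul, sub_self,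
      inner_zero_right]
  pi_t a ξ := norm_clm_eq_zero fun u v => by
    rw [map_sub, map_mul, sub_apply, mul_apply_eq_comp, rho_pi, rho_t, rho_t, r.pi_t, sub_self,
      inner_zero_right]
  t_t ξ η := norm_clm_eq_zero fun u v => by
    rw [star_gen, map_sub, map_mul, sub_apply, mul_apply_eq_comp, Gen.adj, rho_tAdj, rho_t, rho_pi,
      r.tAdj_t, sub_self, inner_zero_right]

/-- The vector functional `x ↦ ⟨v, ρ(x) v⟩` on the free algebra. -/
def vecFree (v : V) : Free X →L[ℂ] ℂ :=
  LinearMap.mkContinuous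
    { toFun := fun x => ⟪v, r.rho x v⟫_ℂ
      map_add' := fun x y => by rw [map_add, add_apply, inner_add_right]
      map_smul' := fun c x => by rw [map_smul, smul_apply, inner_smul_right]; rfl } (‖v‖ ^ 2)
    fun x => by
      change ‖⟪v, r.rho x v⟫_ℂ‖ ≤ _
      have h1 : ‖r.rho x‖ ≤ ‖x‖ := r.toeplitzSeminorm.le_norm x
      calc ‖⟪v, r.rho x v⟫_ℂ‖ ≤ ‖v‖ * (‖x‖ * ‖v‖) := (norm_inner_le_norm _ _).trans
            (mul_le_mul_of_nonneg_left (((r.rho x).le_opNorm v).trans (by gcongr)) (norm_nonneg _))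
        _ = _ := by ring

/-- The vector functional on the completion. -/
def vec (v : V) : Compl X →L[ℂ] ℂ := (r.vecFree v).fromCompletion

theorem vec_coe (v : V) (x : Free X) : r.vec v (x : Compl X) = ⟪v, r.rho x v⟫_ℂ :=
  ContinuousLinearMap.fromCompletion_apply_coe _ _

theorem vec_nonneg (v : V) (y : Compl X) : 0 ≤ r.vec v (star y * y) := by
  refine closure_range_coe X {y | 0 ≤ r.vec v (star y * y)} ?_ (fun x => ?_) y
  · exact isClosed_le continuous_const
      ((r.vec v).continuous.comp ((continuous_star_compl X).mul continuous_id))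
  · change 0 ≤ r.vec v (star (x : Compl X) * (x : Compl X))
    rw [star_coe, ← UniformSpace.Completion.coe_mul, vec_coe, map_mul, mul_apply_eq_comp,
      ← inner_rho_star, star_star, inner_self_eq_norm_sq_to_K]
    rw [← RCLike.ofReal_pow]
    exact RCLike.ofReal_nonneg.2 (sq_nonneg ‖r.rho x v‖)

theorem vec_one (v : V) : r.vec v 1 = ⟪v, v⟫_ℂ := by
  rw [← UniformSpace.Completion.coe_one, vec_coe, map_one]
  rfl

theorem vec_piC (v : V) (a : A) : r.vec v (piC X a) = ⟪v, r.pi a v⟫_ℂ := by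
  rw [← coe_gen_pi, vec_coe, rho_pi]

theorem vec_mul_star_tC {v : V} {ξ : E} (h : r.tAdj ξ v = 0) (y : Compl X) :
    r.vec v (y * star (tC X ξ)) = 0 := by
  refine closure_range_coe X {y | r.vec v (y * star (tC X ξ)) = 0} ?_ (fun x => ?_) y
  · exact isClosed_eq ((r.vec v).continuous.comp (continuous_mul_const _)) continuous_const
  · change r.vec v (x * star (tC X ξ)) = 0
    rw [← coe_gen_tAdj, ← UniformSpace.Completion.coe_mul, vec_coe, map_mul, mul_apply_eq_comp,
      rho_tAdj, h, map_zero, inner_zero_right]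

end PreRep

end PreRep

/-! ### The Fock space of a positive functional -/

section FockSpace

variable {E : Type*}

variable (E) in
/-- The formal linear combinations of nonempty lists of vectors of `E`: the elementary tensors in
the algebraic Fock space of `E` without its degree zero part. No multilinearity is imposed; it holds
up to vectors of length zero for the form `fockForm`. -/
abbrev Fock := E × List E →₀ ℂ

/-- Sesquilinear forms on the Fock space are determined by their values on elementary tensors. -/
theorem fock_ext {f g : Fock E →ₗ⋆[ℂ] Fock E →ₗ[ℂ] ℂ}
    (h : ∀ x y, f (.single x 1) (.single y 1) = g (.single x 1) (.single y 1)) : f = g := by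
  refine LinearMap.ext fun u => LinearMap.ext fun v => ?_
  induction u using Finsupp.induction_linear with
  | zero => simp
  | add u u' h1 h2 => simp [h1, h2]
  | single x c =>
    induction v using Finsupp.induction_linear with
    | zero => simp
    | add v v' h1 h2 => simp only [map_add, h1, h2]
    | single y d =>
      rw [← mul_one c, ← mul_one d, ← smul_eq_mul, ← smul_eq_mul, ← Finsupp.smul_single,
        ← Finsupp.smul_single, LinearMap.map_smulₛₗ₂, LinearMap.map_smulₛₗ₂, map_smul, map_smul, h]

/-- Creation: `T_ξ (η ⊗ ⋯) = ξ ⊗ η ⊗ ⋯`. -/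
def fockT (ξ : E) : Fock E →ₗ[ℂ] Fock E :=
  Finsupp.linearCombination ℂ fun x => Finsupp.single (ξ, x.1 :: x.2) 1

@[simp]
theorem fockT_single (ξ : E) (x : E × List E) :
    fockT ξ (.single x 1) = Finsupp.single (ξ, x.1 :: x.2) 1 := by simp [fockT]

end FockSpace

section Fock

variable {A E : Type*} [NonUnitalCStarAlgebra A] [PartialOrder A] [StarOrderedRing A]
  [NormedAddCommGroup E] [NormedSpace ℂ E] [SMul Aᵐᵒᵖ E] [CStarModule Aᵐᵒᵖ E]
  (X : Correspondence A E) (τ : A →L[ℂ] ℂ)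

/-- The `A`-valued inner product of the elementary tensors `ξ ⊗ r₁ ⊗ ⋯ ⊗ rₙ` and
`η ⊗ s₁ ⊗ ⋯ ⊗ sₘ`; it is zero if their lengths differ. -/
def tip : E → List E → E → List E → A
  | ξ, [], η, [] => ip A ξ η
  | ξ, ξ' :: r, η, η' :: s => tip ξ' r (X.Φ (ip A ξ η) η') s
  | _, _, _, _ => 0

theorem tip_Φ_left (a : A) (ξ η : E) (r s : List E) :
    tip X (X.Φ a ξ) r η s = tip X ξ r (X.Φ (star a) η) s := by
  match r, s with
  | [], [] => simp only [tip, X.adjoint]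
  | _ :: _, _ :: _ => simp only [tip, X.adjoint]
  | [], _ :: _ => simp only [tip]
  | _ :: _, [] => simp only [tip]

theorem star_tip (ξ η : E) (r s : List E) : star (tip X ξ r η s) = tip X η s ξ r := by
  induction r generalizing ξ η s with
  | nil =>
    cases s with
    | nil => simp only [tip, star_ip]
    | cons η' s => simp only [tip, star_zero]
  | cons ξ' r ih =>
    cases s with
    | nil => simp only [tip, star_zero]
    | cons η' s => simp only [tip]; rw [ih, tip_Φ_left, star_ip]

/-- The inner product of elementary tensors is bounded and linear in the first factor of its second
argument. -/
theorem exists_tip_eq (ξ : E) (r s : List E) : ∃ ℓ : E →L[ℂ] A, ∀ η, tip X ξ r η s = ℓ η := by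
  induction r generalizing ξ s with
  | nil =>
    cases s with
    | nil => exact ⟨ipL A ξ, fun η => by simp only [tip]; rfl⟩
    | cons η' s => exact ⟨0, fun η => by simp only [tip]; rfl⟩
  | cons ξ' r ih =>
    cases s with
    | nil => exact ⟨0, fun η => by simp only [tip]; rfl⟩
    | cons η' s =>
      obtain ⟨ℓ, hℓ⟩ := ih ξ' s
      exact ⟨ℓ.comp ((X.orbit η').comp (ipL A ξ)), fun η => by simp only [tip]; exact hℓ _⟩

/-- The sesquilinear form of the Fock space that `τ` defines. -/
def fockForm : Fock E →ₗ⋆[ℂ] Fock E →ₗ[ℂ] ℂ :=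
  LinearMap.mk₂'ₛₗ (starRingEnd ℂ) (RingHom.id ℂ)
    (fun u v => u.sum fun x a => v.sum fun y b => star a * (b * τ (tip X x.1 x.2 y.1 y.2)))
    (fun u u' v => Finsupp.sum_add_index' (by simp) (by simp [add_mul]))
    (fun c u v => by
      rw [Finsupp.sum_smul_index' (by simp), Finsupp.smul_sum]
      refine Finsupp.sum_congr fun x _ => ?_
      rw [Finsupp.smul_sum]
      simp only [smul_eq_mul, star_mul', mul_assoc, starRingEnd_apply])
    (fun u v v' => by
      rw [← Finsupp.sum_add]
      exact Finsupp.sum_congr fun x _ =>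
        Finsupp.sum_add_index' (by simp) (by simp [add_mul, mul_add]))
    (fun c u v => by
      rw [Finsupp.smul_sum]
      refine Finsupp.sum_congr fun x _ => ?_
      rw [Finsupp.sum_smul_index' (by simp), Finsupp.smul_sum]
      refine Finsupp.sum_congr fun y _ => ?_
      simp only [smul_eq_mul, RingHom.id_apply]
      ring)

theorem fockForm_add_left (u u' v : Fock E) :
    fockForm X τ (u + u') v = fockForm X τ u v + fockForm X τ u' v :=
  LinearMap.map_add₂ _ _ _ _

theorem fockForm_smul_smul (c d : ℂ) (u v : Fock E) :
    fockForm X τ (c • u) (d • v) = star c * d * fockForm X τ u v := by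
  rw [LinearMap.map_smulₛₗ₂, map_smul, smul_eq_mul, smul_eq_mul, ← mul_assoc]
  rfl

theorem fockForm_single_single (x y : E × List E) (a b : ℂ) :
    fockForm X τ (.single x a) (.single y b) = star a * (b * τ (tip X x.1 x.2 y.1 y.2)) := by
  simp [fockForm]

theorem fockForm_single (x y : E × List E) :
    fockForm X τ (.single x 1) (.single y 1) = τ (tip X x.1 x.2 y.1 y.2) := by
  simp [fockForm]

/-- The left action: `Π(a) (η ⊗ ⋯) = Φ(a) η ⊗ ⋯`. -/
def fockPi (a : A) : Fock E →ₗ[ℂ] Fock E :=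
  Finsupp.linearCombination ℂ fun x => Finsupp.single (X.Φ a x.1, x.2) 1

/-- Annihilation on elementary tensors: `T_ξ^* (η ⊗ η' ⊗ ⋯) = Φ(⟨ξ, η⟩) η' ⊗ ⋯` and
`T_ξ^* η = 0`. -/
def fockAnn (ξ : E) : E × List E → Fock E
  | (_, []) => 0
  | (η, η' :: s) => Finsupp.single (X.Φ (ip A ξ η) η', s) 1

/-- Annihilation. -/
def fockTAdj (ξ : E) : Fock E →ₗ[ℂ] Fock E := Finsupp.linearCombination ℂ (fockAnn X ξ)

/-- The component of degree one, as a vector of `E`. -/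
def fockOne : Fock E →ₗ[ℂ] E :=
  Finsupp.linearCombination ℂ fun x => match x with
    | (ξ, []) => ξ
    | (_, _ :: _) => 0

variable {X}

@[simp]
theorem fockPi_single (a : A) (x : E × List E) :
    fockPi X a (.single x 1) = Finsupp.single (X.Φ a x.1, x.2) 1 := by simp [fockPi]

@[simp]
theorem fockTAdj_single (ξ : E) (x : E × List E) :
    fockTAdj X ξ (.single x 1) = fockAnn X ξ x := by simp [fockTAdj]

@[simp]
theorem fockOne_single (x : E × List E) :
    fockOne (.single x 1) = match x with
      | (ξ, []) => ξ
      | (_, _ :: _) => 0 := by simp [fockOne]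

variable (X)

theorem fockForm_pi (a : A) (u v : Fock E) :
    fockForm X τ (fockPi X a u) v = fockForm X τ u (fockPi X (star a) v) := by
  have : (fockForm X τ).comp (fockPi X a) = (fockForm X τ).compl₂ (fockPi X (star a)) :=
    fock_ext fun x y => by
      rw [LinearMap.comp_apply, LinearMap.compl₂_apply, fockPi_single, fockPi_single,
        fockForm_single, fockForm_single, tip_Φ_left]
  exact LinearMap.congr_fun (LinearMap.congr_fun this u) v

theorem fockForm_t (ξ : E) (u v : Fock E) :
    fockForm X τ (fockT ξ u) v = fockForm X τ u (fockTAdj X ξ v) := by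
  have : (fockForm X τ).comp (fockT ξ) = (fockForm X τ).compl₂ (fockTAdj X ξ) :=
    fock_ext fun x y => by
      rw [LinearMap.comp_apply, LinearMap.compl₂_apply, fockT_single, fockTAdj_single,
        fockForm_single]
      match y with
      | (η, []) => simp [tip, fockAnn]
      | (η, η' :: s) => simp only [tip, fockAnn]; rw [fockForm_single]
  exact LinearMap.congr_fun (LinearMap.congr_fun this u) v

theorem fockForm_pi_add (a b : A) (u v : Fock E) :
    fockForm X τ u (fockPi X (a + b) v) =
      fockForm X τ u (fockPi X a v) + fockForm X τ u (fockPi X b v) := by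
  have : (fockForm X τ).compl₂ (fockPi X (a + b)) =
      (fockForm X τ).compl₂ (fockPi X a) + (fockForm X τ).compl₂ (fockPi X b) :=
    fock_ext fun x y => by
      obtain ⟨ℓ, hℓ⟩ := exists_tip_eq X x.1 x.2 y.2
      change _ = fockForm X τ _ _ + fockForm X τ _ _
      simp only [LinearMap.compl₂_apply, add_apply, fockPi_single, fockForm_single, hℓ, map_add]
  exact LinearMap.congr_fun (LinearMap.congr_fun this u) v

theorem fockForm_pi_smul (c : ℂ) (a : A) (u v : Fock E) :
    fockForm X τ u (fockPi X (c • a) v) = c * fockForm X τ u (fockPi X a v) := by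
  have : (fockForm X τ).compl₂ (fockPi X (c • a)) = c • (fockForm X τ).compl₂ (fockPi X a) :=
    fock_ext fun x y => by
      obtain ⟨ℓ, hℓ⟩ := exists_tip_eq X x.1 x.2 y.2
      change _ = c • fockForm X τ _ _
      simp only [LinearMap.compl₂_apply, smul_apply, fockPi_single, fockForm_single, hℓ, map_smul]
  exact LinearMap.congr_fun (LinearMap.congr_fun this u) v

theorem fockPi_mul (a b : A) (v : Fock E) : fockPi X (a * b) v = fockPi X a (fockPi X b v) := by
  have : fockPi X (a * b) = (fockPi X a).comp (fockPi X b) :=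
    Finsupp.lhom_ext' fun x => LinearMap.ext_ring (by simp)
  exact LinearMap.congr_fun this v

theorem fockPi_t (a : A) (ξ : E) (v : Fock E) : fockPi X a (fockT ξ v) = fockT (X.Φ a ξ) v := by
  have : (fockPi X a).comp (fockT ξ) = fockT (X.Φ a ξ) :=
    Finsupp.lhom_ext' fun x => LinearMap.ext_ring (by simp)
  exact LinearMap.congr_fun this v

theorem fockTAdj_t (ξ η : E) (v : Fock E) :
    fockTAdj X ξ (fockT η v) = fockPi X (ip A ξ η) v := by
  have : (fockTAdj X ξ).comp (fockT η) = fockPi X (ip A ξ η) :=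
    Finsupp.lhom_ext' fun x => LinearMap.ext_ring (by simp [fockAnn])
  exact LinearMap.congr_fun this v

variable {τ}

theorem fockForm_conj (hτ : ∀ a, 0 ≤ τ (star a * a)) (u v : Fock E) :
    star (fockForm X τ u v) = fockForm X τ v u := by
  induction u using Finsupp.induction_linear with
  | zero => simp
  | add u u' h1 h2 => rw [LinearMap.map_add₂, map_add, star_add, h1, h2]
  | single x c =>
    induction v using Finsupp.induction_linear with
    | zero => simp
    | add v v' h1 h2 => rw [map_add, LinearMap.map_add₂, star_add, h1, h2]
    | single y d =>
      rw [fockForm_single_single, fockForm_single_single, star_mul', star_mul', star_star,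
        ← map_star_of_positive hτ, star_tip]
      ring

/-- The frame expands the form: the inner product of `u` and `v` is the sum of that of their degree
one parts and of those of `T_ζ^* u` and `T_ζ^* v`, with `ζ` in the frame. -/
theorem IsFrame.tendsto_fockForm {Λ : Set E} (hΛ : IsFrame A Λ) (u v : Fock E) :
    Tendsto (fun F : Finset Λ => τ (ip A (fockOne u) (fockOne v)) +
      ∑ ζ ∈ F, fockForm X τ (fockTAdj X (ζ : E) u) (fockTAdj X (ζ : E) v)) atTop
      (𝓝 (fockForm X τ u v)) := by
  have hone : ∀ x y : E × List E, Tendsto (fun F : Finset Λ =>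
      τ (ip A (fockOne (.single x 1)) (fockOne (.single y 1))) +
        ∑ ζ ∈ F, fockForm X τ (fockTAdj X (ζ : E) (.single x 1)) (fockTAdj X (ζ : E) (.single y 1)))
      atTop (𝓝 (fockForm X τ (.single x 1) (.single y 1))) := by
    intro x y
    simp only [fockForm_single, fockTAdj_single, fockOne_single]
    match x, y with
    | (ξ, []), (η, []) => simp [fockAnn, tip]
    | (ξ, []), (η, _ :: _) => simp [fockAnn, tip, ip_zero_right]
    | (ξ, _ :: _), (η, []) => simp [fockAnn, tip, ip_zero_left]
    | (ξ, ξ' :: r), (η, η' :: s) =>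
      obtain ⟨ℓ, hℓ⟩ := exists_tip_eq X ξ' r s
      have h1 := (hΛ.hasSum_ip_mul_ip ξ η).mapL (τ.comp (ℓ.comp (X.orbit η')))
      have h2 : τ (tip X ξ (ξ' :: r) η (η' :: s)) =
          (τ.comp (ℓ.comp (X.orbit η'))) (ip A ξ η) := by
        simp only [tip]
        rw [hℓ]
        rfl
      rw [h2]
      refine Tendsto.congr (fun F => ?_) h1
      simp only [ip_zero_left, map_zero, zero_add]
      refine Finset.sum_congr rfl fun ζ _ => ?_
      simp only [fockAnn]
      rw [fockForm_single, tip_Φ_left, star_ip, hℓ, ← mul_apply_eq_comp, ← map_mul]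
      rfl
  induction u using Finsupp.induction_linear with
  | zero => simp [ip_zero_left]
  | add u u' h1 h2 =>
    rw [fockForm_add_left]
    refine (h1.add h2).congr fun F => ?_
    rw [map_add fockOne, ip_add_left, map_add τ, add_add_add_comm, ← Finset.sum_add_distrib]
    refine congrArg _ (Finset.sum_congr rfl fun ζ _ => ?_)
    rw [map_add (fockTAdj X (ζ : E)), fockForm_add_left]
  | single x c =>
    induction v using Finsupp.induction_linear with
    | zero => simp [ip_zero_right]
    | add v v' h1 h2 =>
      rw [map_add (fockForm X τ _)]
      refine (h1.add h2).congr fun F => ?_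
      rw [map_add fockOne, ip_add_right, map_add τ, add_add_add_comm, ← Finset.sum_add_distrib]
      refine congrArg _ (Finset.sum_congr rfl fun ζ _ => ?_)
      rw [map_add (fockTAdj X (ζ : E)), map_add (fockForm X τ _)]
    | single y d =>
      rw [← mul_one c, ← mul_one d, ← smul_eq_mul, ← smul_eq_mul, ← Finsupp.smul_single,
        ← Finsupp.smul_single, fockForm_smul_smul]
      refine ((hone x y).const_mul (star c * d)).congr fun F => ?_
      rw [map_smul fockOne, map_smul fockOne, ip_smul_left, ip_smul_right, map_smul τ, map_smul τ,
        mul_add, Finset.mul_sum]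
      refine congrArg₂ _ (mul_assoc _ _ _) (Finset.sum_congr rfl fun ζ _ => ?_)
      rw [map_smul (fockTAdj X (ζ : E)), map_smul (fockTAdj X (ζ : E)), fockForm_smul_smul]

theorem IsFrame.fockForm_nonneg {Λ : Set E} (hΛ : IsFrame A Λ) (hτ : ∀ a, 0 ≤ τ (star a * a))
    (u : Fock E) : 0 ≤ fockForm X τ u u := by
  suffices h : ∀ n : ℕ, ∀ u ∈ Finsupp.supported ℂ ℂ {x : E × List E | x.2.length < n},
      0 ≤ fockForm X τ u u by
    refine h ((u.support.sup fun x => x.2.length) + 1) u ?_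
    exact fun x hx => Nat.lt_succ_of_le (Finset.le_sup (f := fun x : E × List E => x.2.length) hx)
  intro n
  induction n with
  | zero =>
    intro u hu
    have : u = 0 := by simpa [Finsupp.mem_supported] using hu
    simp [this]
  | succ n ih =>
    intro u hu
    refine ge_of_tendsto (hΛ.tendsto_fockForm X u u) (.of_forall fun F => ?_)
    refine add_nonneg ?_ (Finset.sum_nonneg fun ζ _ => ih _ ?_)
    · simpa using mono_of_positive hτ (ip_self_nonneg (A := A) (fockOne u))
    · rw [fockTAdj, Finsupp.linearCombination_apply]
      refine Submodule.sum_mem _ fun x hx => Submodule.smul_mem _ _ ?_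
      have hlen : x.2.length < n + 1 := hu hx
      match x with
      | (_, []) => exact Submodule.zero_mem _
      | (η, η' :: s) =>
        refine Finsupp.single_mem_supported ℂ 1 ?_
        simpa using hlen

variable (τ)

/-- The semi-inner product of the Fock space. -/
abbrev fockCore {Λ : Set E} (hΛ : IsFrame A Λ) (hτ : ∀ a, 0 ≤ τ (star a * a)) :
    PreInnerProductSpace.Core ℂ (Fock E) where
  inner u v := fockForm X τ u v
  conj_inner_symm u v := fockForm_conj X hτ v u
  re_inner_nonneg u := (RCLike.nonneg_iff.1 (hΛ.fockForm_nonneg X hτ u)).1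
  add_left _ _ _ := LinearMap.map_add₂ _ _ _ _
  smul_left _ _ _ := LinearMap.map_smulₛₗ₂ _ _ _ _

/-- The vector functionals of the degree one vectors `ζ` of the Fock space: the positive functionals
`x ↦ τ(⟨ζ, x ζ⟩)` on the Cuntz-Toeplitz algebra. -/
theorem exists_fock_functional {Λ : Set E} (hΛ : IsFrame A Λ) (hτ : ∀ a, 0 ≤ τ (star a * a))
    (ζ : E) : ∃ φ : Compl X →L[ℂ] ℂ, (∀ y, 0 ≤ φ (star y * y)) ∧ φ 1 = τ (ip A ζ ζ) ∧
      (∀ a, φ (piC X a) = τ (ip A ζ (X.Φ a ζ))) ∧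
      ∀ y ξ, φ (y * star (tC X ξ)) = 0 := by
  let core := fockCore X τ hΛ hτ
  let : SeminormedAddCommGroup (Fock E) :=
    InnerProductSpace.Core.toSeminormedAddCommGroup (c := core)
  let : InnerProductSpace ℂ (Fock E) := InnerProductSpace.ofCore core
  let r : PreRep X (Fock E) :=
    { pi := fockPi X
      t := fockT
      tAdj := fockTAdj X
      inner_pi_add := fockForm_pi_add X τ
      inner_pi_smul := fockForm_pi_smul X τ
      pi_mul := fockPi_mul X
      pi_t := fockPi_t X
      tAdj_t := fockTAdj_t X
      adj_pi := fockForm_pi X τ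
      adj_t := fockForm_t X τ }
  refine ⟨r.vec (.single (ζ, []) 1), r.vec_nonneg _, ?_, fun a => ?_, fun y ξ => ?_⟩
  · rw [r.vec_one]
    change fockForm X τ _ _ = _
    rw [fockForm_single]
    simp only [tip]
  · rw [r.vec_piC]
    change fockForm X τ _ (fockPi X a _) = _
    rw [fockPi_single, fockForm_single]
    simp only [tip]
  · refine r.vec_mul_star_tC ?_ y
    change fockTAdj X ξ _ = 0
    rw [fockTAdj_single]
    rfl

end Fock

/-! ### Extending a trace to an invariant functional -/

section Sums

variable {B : Type*} [CStarAlgebra B]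

theorem norm_map_le_of_positive {ω : B →L[ℂ] ℂ} (h : ∀ x, 0 ≤ ω (star x * x)) (x : B) :
    ‖ω x‖ ≤ ‖ω 1‖ * ‖x‖ := by
  have h1 := norm_map_conj_le h 1 x
  rw [star_one, one_mul, mul_one, mul_one] at h1
  rw [mul_comm]
  exact h1.trans (mul_le_mul_of_nonneg_left (Complex.re_le_norm _) (norm_nonneg _))

/-- A family of positive functionals on a unital `C*`-algebra is summable as soon as it is summable
at `1`. -/
theorem exists_hasSum_of_positive {ι : Type*} (f : ι → B →L[ℂ] ℂ)
    (hf : ∀ i x, 0 ≤ f i (star x * x)) (hs : Summable fun i => f i 1) :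
    ∃ g : B →L[ℂ] ℂ, (∀ x, 0 ≤ g (star x * x)) ∧ ∀ x, HasSum (fun i => f i x) (g x) := by
  have hsum : Summable f := Summable.of_norm_bounded hs.norm fun i =>
    ContinuousLinearMap.opNorm_le_bound _ (norm_nonneg _) (norm_map_le_of_positive (hf i))
  have h : ∀ x, HasSum (fun i => f i x) ((∑' i, f i) x) := fun x =>
    hsum.hasSum.mapL (ContinuousLinearMap.apply ℂ ℂ x)
  exact ⟨_, fun x => (h _).nonneg fun i => hf i x, h⟩

end Sums

section TraceExtension

variable {A E : Type*} [NonUnitalCStarAlgebra A] [PartialOrder A] [StarOrderedRing A]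
  [NormedAddCommGroup E] [NormedSpace ℂ E] [SMul Aᵐᵒᵖ E] [CStarModule Aᵐᵒᵖ E]
  {X : Correspondence A E} {Λ : Set E} {β : ℝ} {τ : A →L[ℂ] ℂ}

/-- A gauge invariant state `φ` of `Compl X` with `φ ∘ Π = τ` that has the image of `Π` in its
centralizer. Gauge invariance is stated as vanishing on the words of nonzero degree. -/
structure IsTraceExtension (X : Correspondence A E) (τ : A →L[ℂ] ℂ) (φ : Compl X →L[ℂ] ℂ) :
    Prop where
  nonneg : ∀ y, 0 ≤ φ (star y * y)
  map_one : φ 1 = 1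
  map_piC : ∀ a, φ (piC X a) = τ a
  comm : ∀ a x, φ (piC X a * x) = φ (x * piC X a)
  map_word : ∀ d y, d ≠ 0 → IsWord X d y → φ y = 0

theorem IsTraceExtension.norm_map_le {φ : Compl X →L[ℂ] ℂ} (h : IsTraceExtension X τ φ)
    (x : Compl X) : ‖φ x‖ ≤ ‖x‖ := by
  simpa [h.map_one] using norm_map_le_of_positive h.nonneg x

theorem eq_of_words {φ ψ : Compl X →L[ℂ] ℂ} (h : ∀ d y, IsWord X d y → φ y = ψ y)
    (y : Compl X) : φ y = ψ y := by
  rw [← sub_eq_zero]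
  exact mem_of_words (LinearMap.ker (φ - ψ).toLinearMap) (ContinuousLinearMap.isClosed_ker (φ - ψ))
    (fun d y hy => sub_eq_zero.2 (h d y hy)) y

/-- The commutation relation of `IsTraceExtension` has to be checked only on words of degree zero
that are longer than a single `Π(a)`. -/
theorem comm_of_words {φ : Compl X →L[ℂ] ℂ} (hτ : ∀ a b, τ (a * b) = τ (b * a))
    (hp : ∀ a, φ (piC X a) = τ a) (hw : ∀ d y, d ≠ 0 → IsWord X d y → φ y = 0)
    (ht : ∀ a ξ η x, φ (tC X (X.Φ a ξ) * x * star (tC X η)) =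
      φ (tC X ξ * x * star (tC X (X.Φ (star a) η)))) (a : A) (x : Compl X) :
    φ (piC X a * x) = φ (x * piC X a) := by
  refine eq_of_words (φ := φ.comp (ContinuousLinearMap.mul ℂ (Compl X) (piC X a)))
    (ψ := φ.comp ((ContinuousLinearMap.mul ℂ (Compl X)).flip (piC X a))) (fun d y hy => ?_) x
  change φ (piC X a * y) = φ (y * piC X a)
  by_cases hd : d = 0
  · subst hd
    refine IsWord.zero_induction (P := fun y => φ (piC X a * y) = φ (y * piC X a)) hy ?_ ?_ ?_
    · rw [one_mul, mul_one]
    · intro b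
      rw [← map_mul (piC X), ← map_mul (piC X), hp, hp, hτ]
    · intro x _ _ ξ η
      rw [mul_assoc _ _ (piC X a), star_tC_mul_piC, ← ht, ← piC_mul_tC]
      simp only [mul_assoc]
  · rw [hw d _ hd (hy.piC_mul a), hw d _ hd (hy.mul_piC a)]

/-- The sum of the vector functionals of the vectors `ζ ∈ Λ` of the Fock space, divided by `e^β`. -/
theorem exists_isTraceExtension (hΛ : IsFrame A Λ) (hτ : τ ∈ scalingTraces X Λ β) :
    ∃ φ : Compl X →L[ℂ] ℂ, IsTraceExtension X τ φ := by
  choose f hf0 hf1 hfp hft using exists_fock_functional X τ hΛ hτ.1.nonneg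
  have he : (0 : ℂ) ≤ (Real.exp (-β) : ℂ) := by exact_mod_cast (Real.exp_pos _).le
  obtain ⟨φ, hφ0, hφ⟩ := exists_hasSum_of_positive
    (fun ζ : Λ => (Real.exp (-β) : ℂ) • f (ζ : E)) (fun ζ y => mul_nonneg he (hf0 _ y))
    (by simpa [hf1] using hτ.2.1.summable)
  have hr : ∀ y ξ, φ (y * star (tC X ξ)) = 0 := fun y ξ =>
    (hφ _).unique (by simp [hft])
  have hl : ∀ y ξ, φ (tC X ξ * y) = 0 := fun y ξ => by
    have := map_star_of_positive hφ0 (star y * star (tC X ξ))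
    rwa [hr, star_zero, star_mul, star_star, star_star] at this
  have hp : ∀ a, φ (piC X a) = τ a := fun a =>
    (hφ _).unique (by simpa [hfp] using hτ.2.2 a)
  have hw : ∀ d y, d ≠ 0 → IsWord X d y → φ y = 0 := by
    rintro _ _ hd ⟨L, R, c, hc, rfl, rfl⟩
    match L, R with
    | ξ :: L, R => rw [List.map_cons, List.prod_cons, mul_assoc, mul_assoc, hl]
    | [], η :: R => rw [List.map_cons, List.prod_cons, star_mul, ← mul_assoc, hr]
    | [], [] => simp at hd
  refine ⟨φ, hφ0, ?_, hp, comm_of_words hτ.1.tracial hp hw fun a ξ η x => ?_, hw⟩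
  · exact (hφ _).unique (by simpa [hf1] using hτ.2.1)
  · rw [hr, hr]

/-- The map `φ ↦ e^{-β} ∑_ζ φ(T_ζ^* · T_ζ)` preserves the extensions of a trace that satisfies the
scaling condition. -/
theorem IsTraceExtension.exists_next (hΛ : IsFrame A Λ) (hτ : τ ∈ scalingTraces X Λ β)
    {φ : Compl X →L[ℂ] ℂ} (h : IsTraceExtension X τ φ) :
    ∃ ψ : Compl X →L[ℂ] ℂ, IsTraceExtension X τ ψ ∧ ∀ ξ η x,
      ψ (tC X ξ * x * star (tC X η)) = (Real.exp (-β) : ℂ) * φ (x * piC X (ip A η ξ)) := by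
  have he : (0 : ℂ) ≤ (Real.exp (-β) : ℂ) := by exact_mod_cast (Real.exp_pos _).le
  let f : Λ → Compl X →L[ℂ] ℂ := fun ζ => (Real.exp (-β) : ℂ) •
    φ.comp ((ContinuousLinearMap.mul ℂ (Compl X) (star (tC X (ζ : E)))).comp
      ((ContinuousLinearMap.mul ℂ (Compl X)).flip (tC X (ζ : E))))
  have hf : ∀ ζ y, f ζ y = (Real.exp (-β) : ℂ) * φ (star (tC X (ζ : E)) * (y * tC X (ζ : E))) :=
    fun _ _ => rfl
  have hf1 : ∀ ζ, f ζ 1 = (Real.exp (-β) : ℂ) * τ (ip A (ζ : E) (ζ : E)) := fun ζ => by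
    rw [hf, one_mul, star_tC_mul_tC, h.map_piC]
  obtain ⟨ψ, hψ0, hψ⟩ := exists_hasSum_of_positive f (fun ζ y => by
    rw [hf]
    refine mul_nonneg he ?_
    have := h.nonneg (y * tC X (ζ : E))
    rw [star_mul] at this
    simpa only [mul_assoc] using this) (by simpa only [hf1] using hτ.2.1.summable)
  have hp : ∀ a, ψ (piC X a) = τ a := fun a => (hψ _).unique <| by
    simpa only [hf, piC_mul_tC, star_tC_mul_tC, h.map_piC] using hτ.2.2 a
  have hw : ∀ d y, d ≠ 0 → IsWord X d y → ψ y = 0 := fun d y hd hy => (hψ _).unique <| by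
    have : ∀ ζ, f ζ y = 0 := fun ζ => by
      rw [hf, h.map_word d _ hd (by simpa using (hy.mul_tC (ζ : E)).star_tC_mul (ζ : E)), mul_zero]
    simp [this]
  have hrec : ∀ ξ η x, ψ (tC X ξ * x * star (tC X η)) =
      (Real.exp (-β) : ℂ) * φ (x * piC X (ip A η ξ)) := fun ξ η x => (hψ _).unique <| by
    have h1 : ∀ ζ : Λ, f ζ (tC X ξ * x * star (tC X η)) = (Real.exp (-β) : ℂ) *
        φ (x * piC X (ip A η (ζ : E) * ip A (ζ : E) ξ)) := fun ζ => by
      have h2 : star (tC X (ζ : E)) * (tC X ξ * x * star (tC X η) * tC X (ζ : E)) =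
          piC X (ip A (ζ : E) ξ) * (x * piC X (ip A η (ζ : E))) := by
        rw [← star_tC_mul_tC, ← star_tC_mul_tC]
        simp only [mul_assoc]
      rw [hf, h2, h.comm, map_mul (piC X), mul_assoc]
    simp only [h1]
    refine HasSum.mul_left _ ?_
    exact (hΛ.hasSum_ip_mul_ip η ξ).map
      ((φ.comp (ContinuousLinearMap.mul ℂ (Compl X) x)).toLinearMap.toAddMonoidHom.comp
        (piC X : A →+ Compl X))
      ((φ.comp (ContinuousLinearMap.mul ℂ (Compl X) x)).continuous.comp (continuous_piC X))
  refine ⟨ψ, ⟨hψ0, ?_, hp, comm_of_words hτ.1.tracial hp hw fun a ξ η x => ?_, hw⟩, hrec⟩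
  · exact (hψ _).unique (by simpa only [hf1] using hτ.2.1)
  · rw [hrec, hrec, X.adjoint, star_star]

/-- A uniformly bounded sequence of functionals converges pointwise on a closed set. -/
theorem isClosed_setOf_cauchySeq {F : Type*} [NormedAddCommGroup F] [NormedSpace ℂ F]
    (φ : ℕ → F →L[ℂ] ℂ) (hφ : ∀ n x, ‖φ n x‖ ≤ ‖x‖) :
    IsClosed {x | CauchySeq fun n => φ n x} := by
  refine isClosed_of_closure_subset fun x hx => ?_
  rw [Set.mem_ofPred_eq, Metric.cauchySeq_iff]
  intro ε hε
  obtain ⟨y, hy, hxy⟩ := Metric.mem_closure_iff.1 hx (ε / 3) (by positivity)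
  obtain ⟨N, hN⟩ := Metric.cauchySeq_iff.1 hy (ε / 3) (by positivity)
  refine ⟨N, fun m hm n hn => ?_⟩
  have h1 : ∀ k, dist (φ k x) (φ k y) ≤ dist x y := fun k => by
    rw [dist_eq_norm, dist_eq_norm, ← map_sub]
    exact hφ k _
  have h2 := h1 m
  have h3 := h1 n
  rw [dist_comm] at h3
  linarith [hN m hm n hn, dist_triangle4 (φ m x) (φ m y) (φ n y) (φ n x)]

/-- Iterating the map of `IsTraceExtension.exists_next` converges, because the value at a word of
degree zero no longer changes after as many steps as the word has letters. The limit is a fixed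
point. -/
theorem exists_invariant_isTraceExtension (hΛ : IsFrame A Λ) (hτ : τ ∈ scalingTraces X Λ β) :
    ∃ ω : Compl X →L[ℂ] ℂ, IsTraceExtension X τ ω ∧ ∀ ξ η x,
      ω (tC X ξ * x * star (tC X η)) = (Real.exp (-β) : ℂ) * ω (x * piC X (ip A η ξ)) := by
  obtain ⟨φ₀, h₀⟩ := exists_isTraceExtension hΛ hτ
  choose next hnext hrec using fun φ : {φ // IsTraceExtension X τ φ} =>
    φ.2.exists_next hΛ hτ
  let s : ℕ → {φ // IsTraceExtension X τ φ} :=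
    fun n => Nat.rec ⟨φ₀, h₀⟩ (fun _ φ => ⟨next φ, hnext φ⟩) n
  have hs : ∀ n ξ η x, (s (n + 1)).1 (tC X ξ * x * star (tC X η)) =
      (Real.exp (-β) : ℂ) * (s n).1 (x * piC X (ip A η ξ)) := fun n => hrec (s n)
  have hmul : ∀ y, IsWord X 0 y → ∀ a, CauchySeq fun n => (s n).1 (y * piC X a) := fun y hy => by
    refine IsWord.zero_induction (P := fun y => ∀ a, CauchySeq fun n => (s n).1 (y * piC X a))
      hy ?_ ?_ ?_
    · intro a
      simpa only [one_mul, (s _).2.map_piC] using cauchySeq_const _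
    · intro b a
      simpa only [← map_mul (piC X), (s _).2.map_piC] using cauchySeq_const _
    · intro x _ ih ξ η a
      rw [← cauchySeq_shift 1]
      simp only [mul_assoc _ _ (piC X a), star_tC_mul_piC, hs]
      exact ((CauchySeq.tendsto_limUnder (ih _)).const_mul _).cauchySeq
  have hword : ∀ d y, IsWord X d y → CauchySeq fun n => (s n).1 y := fun d y hy => by
    by_cases hd : d = 0
    · subst hd
      refine IsWord.zero_induction (P := fun y => CauchySeq fun n => (s n).1 y) hy ?_ ?_ ?_
      · simpa only [(s _).2.map_one] using cauchySeq_const _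
      · intro a
        simpa only [(s _).2.map_piC] using cauchySeq_const _
      · intro x hx _ ξ η
        rw [← cauchySeq_shift 1]
        simp only [hs]
        exact ((CauchySeq.tendsto_limUnder (hmul x hx _)).const_mul _).cauchySeq
    · simpa only [(s _).2.map_word d y hd hy] using cauchySeq_const _
  let S : Submodule ℂ (Compl X) :=
    { carrier := {x | CauchySeq fun n => (s n).1 x}
      zero_mem' := by simpa only [Set.mem_ofPred_eq, map_zero] using cauchySeq_const _
      add_mem' := fun {x y} hx hy => by
        simp only [Set.mem_ofPred_eq, map_add] at hx hy ⊢
        exact ((CauchySeq.tendsto_limUnder hx).add (CauchySeq.tendsto_limUnder hy)).cauchySeq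
      smul_mem' := fun c x hx => by
        simp only [Set.mem_ofPred_eq, map_smul] at hx ⊢
        exact ((CauchySeq.tendsto_limUnder hx).const_smul c).cauchySeq }
  have hall : ∀ x, CauchySeq fun n => (s n).1 x :=
    mem_of_words S (isClosed_setOf_cauchySeq _ fun n => (s n).2.norm_map_le) hword
  choose f hf using fun x => cauchySeq_tendsto_of_complete (hall x)
  let ω : Compl X →L[ℂ] ℂ := continuousLinearMapOfTendsto (fun n => (s n).1)
    (tendsto_pi_nhds.2 hf)
  have hω : ∀ x, Tendsto (fun n => (s n).1 x) atTop (𝓝 (ω x)) := hf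
  refine ⟨ω, ⟨fun y => ?_, ?_, fun a => ?_, fun a x => ?_, fun d y hd hy => ?_⟩, fun ξ η x => ?_⟩
  · exact ge_of_tendsto' (hω _) fun n => (s n).2.nonneg y
  · exact tendsto_nhds_unique (hω _) (by simpa only [(s _).2.map_one] using tendsto_const_nhds)
  · exact tendsto_nhds_unique (hω _) (by simpa only [(s _).2.map_piC] using tendsto_const_nhds)
  · exact tendsto_nhds_unique (hω _) (by simpa only [(s _).2.comm] using hω _)
  · exact tendsto_nhds_unique (hω _)
      (by simpa only [(s _).2.map_word d y hd hy] using tendsto_const_nhds)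
  · refine tendsto_nhds_unique ((tendsto_add_atTop_iff_nat 1).2 (hω _)) ?_
    simpa only [hs] using (hω _).const_mul _

/-! ### The KMS condition for words -/

/-- The KMS condition of `ω` for an element `y` of degree `d`. -/
def IsKMSElement (ω : Compl X →L[ℂ] ℂ) (β : ℝ) (d : ℤ) (y : Compl X) : Prop :=
  ∀ x, Complex.exp (-(d * β)) * ω (x * y) = ω (y * x)

theorem IsKMSElement.mul {ω : Compl X →L[ℂ] ℂ} {d e : ℤ} {y z : Compl X}
    (hy : IsKMSElement ω β d y) (hz : IsKMSElement ω β e z) :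
    IsKMSElement ω β (d + e) (y * z) := fun x => by
  have h : Complex.exp (-((d + e : ℤ) * β)) = Complex.exp (-(d * β)) * Complex.exp (-(e * β)) := by
    rw [← Complex.exp_add]
    push_cast
    ring_nf
  rw [h, mul_assoc, ← mul_assoc x, hz, ← mul_assoc, hy, mul_assoc]

theorem IsKMSElement.one {ω : Compl X →L[ℂ] ℂ} : IsKMSElement ω β 0 1 := fun x => by simp

theorem IsKMSElement.star {ω : Compl X →L[ℂ] ℂ} (h0 : ∀ y, 0 ≤ ω (star y * y)) {d : ℤ}
    {y : Compl X} (hy : IsKMSElement ω β d y) : IsKMSElement ω β (-d) (star y) := fun x => by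
  have h := congrArg Star.star (hy (Star.star x))
  rw [star_mul', ← map_star_of_positive h0, ← map_star_of_positive h0, star_mul, star_mul,
    star_star, Complex.star_def, ← Complex.exp_conj] at h
  rw [← h, ← mul_assoc, ← Complex.exp_add]
  simp

/-- An invariant functional satisfies the KMS condition for `T_ξ`: against a word that ends in some
`T_η^*` it is the invariance, and against any other word of the relevant degree both sides vanish.
The condition passes to adjoints and products. -/
theorem IsTraceExtension.isKMSElement {ω : Compl X →L[ℂ] ℂ} (h : IsTraceExtension X τ ω)
    (hrec : ∀ ξ η x, ω (tC X ξ * x * star (tC X η)) =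
      (Real.exp (-β) : ℂ) * ω (x * piC X (ip A η ξ))) {d : ℤ} {y : Compl X} (hy : IsWord X d y) :
    IsKMSElement ω β d y := by
  have ht : ∀ ξ, IsKMSElement ω β 1 (tC X ξ) := fun ξ x => by
    refine eq_of_words (φ := Complex.exp (-((1 : ℤ) * β)) •
        ω.comp ((ContinuousLinearMap.mul ℂ (Compl X)).flip (tC X ξ)))
      (ψ := ω.comp (ContinuousLinearMap.mul ℂ (Compl X) (tC X ξ))) (fun d y hy => ?_) x
    change Complex.exp (-((1 : ℤ) * β)) * ω (y * tC X ξ) = ω (tC X ξ * y)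
    by_cases hd : d + 1 = 0
    · obtain ⟨L, R, c, hc, rfl, rfl⟩ := hy
      match R with
      | [] => simp only [List.length_nil] at hd; omega
      | η :: R =>
        rw [List.map_cons, List.prod_cons, star_mul, ← mul_assoc, mul_assoc _ (Star.star (tC X η)),
          star_tC_mul_tC, ← mul_assoc (tC X ξ), hrec]
        simp
    · rw [h.map_word _ _ hd (hy.mul_tC ξ), h.map_word _ _ hd (hy.tC_mul ξ), mul_zero]
  have hL : ∀ L : List E, IsKMSElement ω β L.length (L.map (tC X)).prod := fun L => by
    induction L with
    | nil => exact IsKMSElement.one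
    | cons ξ L ih =>
      rw [List.map_cons, List.prod_cons, List.length_cons, Nat.cast_succ, add_comm]
      exact (ht ξ).mul ih
  obtain ⟨L, R, c, hc, rfl, rfl⟩ := hy
  have hc' : IsKMSElement ω β 0 c := by
    rcases hc with rfl | ⟨a, rfl⟩
    · exact IsKMSElement.one
    · intro x
      simp [h.comm]
  simpa [sub_eq_add_neg] using ((hL L).mul hc').mul ((hL R).star h.nonneg)

end TraceExtension

/-! ### Periodic entire functions -/

section Entire

/-- Entire functions that agree on the real line are equal. -/
theorem entire_ext {F G : ℂ → ℂ} (hF : Differentiable ℂ F) (hG : Differentiable ℂ G)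
    (h : ∀ s : ℝ, F s = G s) : F = G := by
  refine AnalyticOnNhd.eq_of_frequently_eq (z₀ := 0) (fun z _ => hF.analyticAt z)
    (fun z _ => hG.analyticAt z) ?_
  have h1 : Tendsto (fun s : ℝ => (s : ℂ)) (𝓝[≠] 0) (𝓝[≠] 0) := by
    refine tendsto_nhdsWithin_iff.2 ⟨?_, ?_⟩
    · simpa using (Complex.continuous_ofReal.tendsto (0 : ℝ)).mono_left nhdsWithin_le_nhds
    · filter_upwards [self_mem_nhdsWithin] with s hs
      simpa using hs
  exact h1.frequently (Eventually.of_forall h).frequently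

theorem entire_periodic {F : ℂ → ℂ} (hF : Differentiable ℂ F)
    (h : ∀ s : ℝ, F ((s + 2 * Real.pi : ℝ) : ℂ) = F s) :
    Function.Periodic F ((2 * Real.pi : ℝ) : ℂ) := fun z => by
  refine congrFun (entire_ext (F := fun z => F (z + (2 * Real.pi : ℝ))) (G := F)
    (by fun_prop) hF fun s => ?_) z
  rw [← h s, Complex.ofReal_add]

/-- A continuous function with a real period is bounded on horizontal strips of finite width. -/
theorem exists_bound_of_periodic {F : ℂ → ℂ} (hF : Continuous F)
    (hp : Function.Periodic F ((2 * Real.pi : ℝ) : ℂ)) (b : ℝ) :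
    ∃ C, 0 ≤ C ∧ ∀ z : ℂ, |z.im| ≤ b → ‖F z‖ ≤ C := by
  have hK : IsCompact (Set.Icc (0 : ℝ) (2 * Real.pi) ×ℂ Set.Icc (-b) b) :=
    isCompact_Icc.reProdIm isCompact_Icc
  obtain ⟨C, hC⟩ := hK.exists_bound_of_continuousOn hF.continuousOn
  refine ⟨max C 0, le_max_right _ _, fun z hz => le_max_of_le_left ?_⟩
  have h1 := toIcoMod_mem_Ico Real.two_pi_pos 0 z.re
  have h2 : F (z - (toIcoDiv Real.two_pi_pos 0 z.re : ℤ) * ((2 * Real.pi : ℝ) : ℂ)) = F z :=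
    hp.sub_int_mul_eq _
  rw [← h2]
  refine hC _ ⟨?_, ?_⟩
  · have h3 : (z - (toIcoDiv Real.two_pi_pos 0 z.re : ℤ) * ((2 * Real.pi : ℝ) : ℂ)).re =
        toIcoMod Real.two_pi_pos 0 z.re := by
      rw [toIcoMod, zsmul_eq_mul, Complex.sub_re, ← Complex.ofReal_intCast, ← Complex.ofReal_mul,
        Complex.ofReal_re]
    rw [zero_add] at h1
    rw [Set.mem_preimage, h3]
    exact ⟨h1.1, h1.2.le⟩
  · have h3 : (z - (toIcoDiv Real.two_pi_pos 0 z.re : ℤ) * ((2 * Real.pi : ℝ) : ℂ)).im =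
        z.im := by
      rw [Complex.sub_im, ← Complex.ofReal_intCast, ← Complex.ofReal_mul, Complex.ofReal_im,
        sub_zero]
    rw [Set.mem_preimage, h3]
    exact abs_le.1 hz

/-- The three lines theorem, on the middle line of a horizontal strip. -/
theorem norm_le_on_middle_line {F : ℂ → ℂ} (hF : Differentiable ℂ F)
    (hp : Function.Periodic F ((2 * Real.pi : ℝ) : ℂ)) (β : ℝ) {a b : ℝ}
    (ha : ∀ s : ℝ, ‖F s‖ ≤ a) (hb : ∀ s : ℝ, ‖F (s + β * Complex.I)‖ ≤ b) (t : ℝ) :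
    ‖F (t + β / 2 * Complex.I)‖ ≤ √a * √b := by
  obtain ⟨C, -, hC⟩ := exists_bound_of_periodic hF.continuous hp |β|
  have h := Complex.HadamardThreeLines.norm_le_interp_of_mem_verticalClosedStrip'
    (f := fun w : ℂ => F (t + β * Complex.I * w)) (z := 1 / 2) (a := a) (b := b) (l := 0) (u := 1)
    zero_lt_one ?_ ?_ ?_ ?_ ?_
  · norm_num at h
    rw [← Real.sqrt_eq_rpow, ← Real.sqrt_eq_rpow] at h
    have h1 : (t : ℂ) + β * Complex.I * 2⁻¹ = t + β / 2 * Complex.I := by ring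
    simpa only [h1, one_div] using h
  · simp only [Complex.HadamardThreeLines.verticalClosedStrip, Set.mem_preimage]
    norm_num
  · exact Differentiable.diffContOnCl (by fun_prop)
  · refine ⟨C, ?_⟩
    rintro _ ⟨w, hw, rfl⟩
    refine hC _ ?_
    have hw' : 0 ≤ w.re ∧ w.re ≤ 1 := hw
    have h1 : ((t : ℂ) + β * Complex.I * w).im = β * w.re := by simp
    rw [h1, abs_mul, abs_of_nonneg hw'.1]
    exact mul_le_of_le_one_right (abs_nonneg _) hw'.2
  · intro w hw
    have h1 : (t : ℂ) + β * Complex.I * w = ((t - β * w.im : ℝ) : ℂ) := by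
      refine Complex.ext ?_ ?_
      · simp [sub_eq_add_neg]
      · simpa using Or.inr hw
    rw [h1]
    exact ha _
  · intro w hw
    have hw' : w.re = 1 := hw
    have h1 : (t : ℂ) + β * Complex.I * w = ((t - β * w.im : ℝ) : ℂ) + β * Complex.I := by
      refine Complex.ext ?_ ?_
      · simp [sub_eq_add_neg]
      · simp [hw']
    rw [h1]
    exact hb _

/-- The relation `G (z + iβ) = H z` is inherited by limits that are uniform on the real line. The
three lines theorem, applied to the differences from the approximants, gives `G = H` on the middle
lines of the two strips. -/
theorem eq_shift_of_approx {G H : ℂ → ℂ} (hG : Differentiable ℂ G) (hH : Differentiable ℂ H)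
    (hGp : Function.Periodic G ((2 * Real.pi : ℝ) : ℂ))
    (hHp : Function.Periodic H ((2 * Real.pi : ℝ) : ℂ)) {β : ℝ}
    (h : ∀ ε > 0, ∃ g k : ℂ → ℂ, Differentiable ℂ g ∧ Differentiable ℂ k ∧
      Function.Periodic g ((2 * Real.pi : ℝ) : ℂ) ∧ Function.Periodic k ((2 * Real.pi : ℝ) : ℂ) ∧
      (∀ z, g (z + β * Complex.I) = k z) ∧ (∀ s : ℝ, ‖G s - g s‖ ≤ ε) ∧
      ∀ s : ℝ, ‖H s - k s‖ ≤ ε) : G (β * Complex.I) = H 0 := by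
  obtain ⟨C, hC0, hC⟩ := exists_bound_of_periodic hG.continuous hGp |β|
  obtain ⟨D, hD0, hD⟩ := exists_bound_of_periodic hH.continuous hHp |β|
  have key : ∀ t : ℝ, G (t + β / 2 * Complex.I) = H (t - β / 2 * Complex.I) := fun t => by
    have h1 : ∀ ε ∈ Set.Ioo (0 : ℝ) 1, ‖G (t + β / 2 * Complex.I) - H (t - β / 2 * Complex.I)‖ ≤
        √ε * √(C + D + 1) + √ε * √(C + D + 1) := by
      intro ε ⟨hε, hε1⟩
      obtain ⟨g, k, hg, hk, hgp, hkp, hgk, hGg, hHk⟩ := h ε hε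
      have hk1 : ∀ s : ℝ, ‖k s‖ ≤ D + 1 := fun s => by
        have h2 := norm_sub_norm_le (k s) (H s)
        rw [norm_sub_rev] at h2
        linarith [hHk s, hD s (by simp)]
      have hg1 : ∀ s : ℝ, ‖g s‖ ≤ C + 1 := fun s => by
        have h2 := norm_sub_norm_le (g s) (G s)
        rw [norm_sub_rev] at h2
        linarith [hGg s, hC s (by simp)]
      have h3 := norm_le_on_middle_line (hG.sub hg) (hGp.sub hgp) β (a := ε) (b := C + D + 1)
        hGg (fun s => by
          rw [Pi.sub_apply, hgk]
          linarith [norm_sub_le (G (s + β * Complex.I)) (k s), hk1 s,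
            hC (s + β * Complex.I) (by simp)]) t
      have h4 := norm_le_on_middle_line (hH.sub hk) (hHp.sub hkp) (-β) (a := ε) (b := C + D + 1)
        hHk (fun s => by
          rw [Pi.sub_apply, ← hgk]
          have h5 : (s : ℂ) + ((-β : ℝ) : ℂ) * Complex.I + β * Complex.I = s := by
            push_cast; ring
          rw [h5]
          linarith [norm_sub_le (H (s + ((-β : ℝ) : ℂ) * Complex.I)) (g s), hg1 s,
            hD (s + ((-β : ℝ) : ℂ) * Complex.I) (by simp)]) t
      have h6 : (t : ℂ) + ((-β : ℝ) : ℂ) / 2 * Complex.I = t - β / 2 * Complex.I := by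
        push_cast; ring
      rw [Pi.sub_apply] at h3
      rw [h6, Pi.sub_apply, ← hgk] at h4
      have h7 : (t : ℂ) - β / 2 * Complex.I + β * Complex.I = t + β / 2 * Complex.I := by ring
      rw [h7] at h4
      have h8 := norm_sub_le (G (t + β / 2 * Complex.I) - g (t + β / 2 * Complex.I))
        (H (t - β / 2 * Complex.I) - g (t + β / 2 * Complex.I))
      rw [sub_sub_sub_cancel_right] at h8
      exact h8.trans (add_le_add h3 h4)
    have h2 : Tendsto (fun ε : ℝ => √ε * √(C + D + 1) + √ε * √(C + D + 1)) (𝓝[>] 0) (𝓝 0) := by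
      have : Continuous fun ε : ℝ => √ε * √(C + D + 1) + √ε * √(C + D + 1) := by fun_prop
      simpa using (this.tendsto 0).mono_left nhdsWithin_le_nhds
    have h3 := ge_of_tendsto h2 (by
      filter_upwards [Ioo_mem_nhdsGT (zero_lt_one (α := ℝ))] with ε hε using h1 ε hε)
    exact sub_eq_zero.1 (norm_le_zero_iff.1 h3)
  have h1 := congrFun (entire_ext (F := fun z => G (z + β / 2 * Complex.I))
    (G := fun z => H (z - β / 2 * Complex.I)) (by fun_prop) (by fun_prop) key) (β / 2 * Complex.I)
  simp only [sub_self] at h1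
  rw [← h1]
  congr 1
  ring

end Entire

/-! ### The KMS condition for entire elements -/

section Extension

variable {A E : Type*} [NonUnitalCStarAlgebra A] [PartialOrder A] [StarOrderedRing A]
  [NormedAddCommGroup E] [NormedSpace ℂ E] [SMul Aᵐᵒᵖ E] [CStarModule Aᵐᵒᵖ E]
  {X : Correspondence A E} {Λ : Set E} {β : ℝ} {τ : A →L[ℂ] ℂ}

theorem norm_gaugeCompl_le (z : Circle) (y : Compl X) : ‖gaugeCompl X z y‖ ≤ ‖y‖ :=
  NonUnitalStarAlgHom.norm_apply_le (gaugeCompl X z) y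

theorem gaugeCompl_one (y : Compl X) : gaugeCompl X 1 y = y := by
  let l : Compl X →L[ℂ] Compl X :=
    { toFun := gaugeCompl X 1
      map_add' := map_add _
      map_smul' := map_smul _
      cont := continuous_gaugeCompl X 1 }
  have h := mem_of_words (LinearMap.ker (l - .id ℂ (Compl X)).toLinearMap)
    (ContinuousLinearMap.isClosed_ker (l - .id ℂ (Compl X)))
    (fun d y hy => sub_eq_zero.2 ((hy.gaugeCompl 1).trans (by simp))) y
  exact sub_eq_zero.1 h

theorem gauge_periodic {f : ℂ → Compl X} (hf : Differentiable ℂ f) {y : Compl X}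
    (hfs : ∀ s : ℝ, f s = gaugeCompl X (Circle.exp s) y) (ψ : Compl X →L[ℂ] ℂ) :
    Function.Periodic (fun z => ψ (f z)) ((2 * Real.pi : ℝ) : ℂ) :=
  entire_periodic (by fun_prop) fun s => by
    rw [hfs, hfs, Circle.periodic_exp]

/-- The KMS condition passes from words to all entire elements: the linear combinations of words are
dense, and the entire function of such a combination is an exponential polynomial, which satisfies
the condition by homogeneity. -/
theorem kms_of_isKMSElement {ω : Compl X →L[ℂ] ℂ}
    (h : ∀ d y, IsWord X d y → IsKMSElement ω β d y) (x y : Compl X) (f : ℂ → Compl X)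
    (hf : Differentiable ℂ f) (hfs : ∀ s : ℝ, f s = gaugeCompl X (Circle.exp s) y) :
    ω (x * f (β * Complex.I)) = ω (y * x) := by
  let S : Submodule ℂ (Compl X) :=
    { carrier := {y | ∃ g : ℂ → Compl X, Differentiable ℂ g ∧
        (∀ s : ℝ, g s = gaugeCompl X (Circle.exp s) y) ∧
        ∀ x z, ω (x * g (z + β * Complex.I)) = ω (g z * x)}
      zero_mem' := ⟨0, differentiable_const _, by simp, by simp⟩
      add_mem' := by
        rintro y y' ⟨g, h1, h2, h3⟩ ⟨g', h1', h2', h3'⟩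
        refine ⟨g + g', h1.add h1', fun s => ?_, fun x z => ?_⟩
        · rw [Pi.add_apply, h2, h2', map_add]
        · rw [Pi.add_apply, Pi.add_apply, mul_add, add_mul, map_add, map_add, h3, h3']
      smul_mem' := by
        rintro c y ⟨g, h1, h2, h3⟩
        refine ⟨c • g, h1.const_smul c, fun s => ?_, fun x z => ?_⟩
        · rw [Pi.smul_apply, h2, map_smul]
        · rw [Pi.smul_apply, Pi.smul_apply, mul_smul_comm, smul_mul_assoc, map_smul, map_smul, h3] }
  have hS : ∀ y, y ∈ S.topologicalClosure := by
    refine mem_of_words _ S.isClosed_topologicalClosure fun d y hy => S.le_topologicalClosure ?_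
    refine ⟨fun z => Complex.exp (d * z * Complex.I) • y, by fun_prop, fun s => ?_, fun x z => ?_⟩
    · rw [hy.gaugeCompl, Circle.coe_exp, ← Complex.exp_int_mul, ← mul_assoc]
    · rw [mul_smul_comm, smul_mul_assoc, map_smul, map_smul, ← h d y hy x, smul_eq_mul, smul_eq_mul,
        ← mul_assoc, ← Complex.exp_add]
      congr 2
      linear_combination (d * β : ℂ) * Complex.I_mul_I
  let l : Compl X →L[ℂ] ℂ := ω.comp (ContinuousLinearMap.mul ℂ (Compl X) x)
  let r : Compl X →L[ℂ] ℂ := ω.comp ((ContinuousLinearMap.mul ℂ (Compl X)).flip x)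
  have hf0 : f 0 = y := by
    have h1 := hfs 0
    rw [Complex.ofReal_zero, Circle.exp_zero] at h1
    rw [h1, gaugeCompl_one]
  have key : l (f (β * Complex.I)) = r (f 0) := by
    refine eq_shift_of_approx (G := fun z => l (f z)) (H := fun z => r (f z)) (by fun_prop)
      (by fun_prop) (gauge_periodic hf hfs l) (gauge_periodic hf hfs r) fun ε hε => ?_
    -- one more than needed, to avoid a division by zero
    let M : ℝ := ‖l‖ + ‖r‖ + 1
    have hl : ‖l‖ ≤ M := by dsimp only [M]; linarith [norm_nonneg r]
    have hr : ‖r‖ ≤ M := by dsimp only [M]; linarith [norm_nonneg l]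
    have hM : 0 < M := by dsimp only [M]; positivity
    obtain ⟨y', ⟨g, hg, hgs, hgω⟩, hy'⟩ :=
      Metric.mem_closure_iff.1 (hS y) (ε / M) (by positivity)
    have hb : ∀ (ψ : Compl X →L[ℂ] ℂ), ‖ψ‖ ≤ M → ∀ s : ℝ, ‖ψ (f s) - ψ (g s)‖ ≤ ε :=
      fun ψ hψ s => by
        rw [← map_sub, hfs, hgs, ← map_sub (gaugeCompl X (Circle.exp s))]
        rw [dist_eq_norm] at hy'
        calc _ ≤ M * (ε / M) := ψ.le_of_opNorm_le_of_le hψ ((norm_gaugeCompl_le _ _).trans hy'.le)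
          _ = ε := mul_div_cancel₀ _ hM.ne'
    exact ⟨fun z => l (g z), fun z => r (g z), by fun_prop, by fun_prop, gauge_periodic hg hgs l,
      gauge_periodic hg hgs r, fun z => hgω x z, hb l hl, hb r hr⟩
  rw [hf0] at key
  exact key

variable (X) in
/-- The inclusion of the Cuntz-Toeplitz algebra in its unital enlargement. -/
def inclL : Toeplitz X →L[ℂ] Compl X :=
  LinearMap.mkContinuous
    { toFun := fun y => (y : Compl X), map_add' := fun _ _ => rfl, map_smul' := fun _ _ => rfl }
    1 fun y => by rw [one_mul]; rfl

theorem inclL_apply (y : Toeplitz X) : inclL X y = (y : Compl X) := rfl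

/-- The restriction to `𝒯_E` of the invariant extension of `τ` to `Compl X` keeps norm one, because
it takes values near `1` at the contractions `∑_{ξ ∈ F} T_ξ T_ξ^*`. -/
theorem surjOn_restriction (hΛ : IsFrame A Λ) :
    Set.SurjOn (restriction X) (infiniteKMS X Λ β) (scalingTraces X Λ β) := by
  intro τ hτ
  obtain ⟨ω, hω, hrec⟩ := exists_invariant_isTraceExtension hΛ hτ
  have hsum : HasSum (fun ξ : Λ => ω.comp (inclL X) (T X (ξ : E) * star (T X (ξ : E)))) 1 := by
    refine hτ.2.1.congr_fun fun ξ => ?_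
    change ω (tC X (ξ : E) * star (tC X (ξ : E))) = _
    simpa [hω.map_piC] using hrec (ξ : E) (ξ : E) 1
  refine ⟨ω.comp (inclL X), ⟨⟨⟨fun y => hω.nonneg _, le_antisymm ?_ ?_⟩, fun x y f hf hfs => ?_⟩,
    hsum⟩, ?_⟩
  · refine ContinuousLinearMap.opNorm_le_bound _ zero_le_one fun y => ?_
    rw [one_mul]
    exact hω.norm_map_le _
  · have h1 : Tendsto (fun F : Finset Λ => ‖ω.comp (inclL X) (rangeSum X F)‖) atTop (𝓝 1) := by
      rw [← norm_one (α := ℂ)]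
      refine Tendsto.norm (Tendsto.congr (fun F => ?_) hsum)
      rw [rangeSum, map_sum]
    refine le_of_tendsto h1 (.of_forall fun F => ?_)
    exact (ContinuousLinearMap.le_opNorm _ _).trans
      (mul_le_of_le_one_right (norm_nonneg _) (norm_rangeSum_le X hΛ F))
  · exact kms_of_isKMSElement (fun d y hy => hω.isKMSElement hrec hy) (x : Compl X) (y : Compl X)
      (fun z => inclL X (f z)) (by fun_prop)
      fun s => by rw [hfs, inclL_apply, coe_gauge]
  · ext a
    exact hω.map_piC a

/-! ### Nondegenerate correspondences -/

/-- If `Φ` is nondegenerate, then an approximate unit `e` of `A` satisfies `Φ(e) ξ → ξ`, so that by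
the scaling condition `‖τ‖` is at least `e^{-β} ∑ τ(⟨ξ, ξ⟩) = 1`. -/
theorem isState_of_nondegenerate (hΛ : IsFrame A Λ) (hX : X.Nondegenerate)
    (hτ : τ ∈ scalingTraces X Λ β) : IsState τ := by
  obtain ⟨ω, hω, rfl⟩ := surjOn_restriction hΛ hτ
  refine ⟨hτ.1.nonneg, le_antisymm ?_ ?_⟩
  · refine ContinuousLinearMap.opNorm_le_bound _ zero_le_one fun a => ?_
    rw [restriction_apply]
    refine (ω.le_opNorm _).trans ?_
    rw [hω.1.isState.norm_eq_one]
    exact mul_le_mul_of_nonneg_left (norm_Pi_le X a) zero_le_one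
  have hl := CStarAlgebra.increasingApproximateUnit A
  have : (CStarAlgebra.approximateUnit A).NeBot := hl.neBot
  set τ := restriction X ω
  have he : (0 : ℂ) ≤ (Real.exp (-β) : ℂ) := by exact_mod_cast (Real.exp_pos _).le
  have hξ : ∀ ξ, Tendsto (fun e => X.Φ e ξ) (CStarAlgebra.approximateUnit A) (𝓝 ξ) := fun ξ => by
    rw [Metric.tendsto_nhds]
    intro ε hε
    have hmem : ξ ∈ (Submodule.span ℂ {ζ | ∃ (a : A) (ξ : E), ζ = X.Φ a ξ}).topologicalClosure := by
      rw [show _ = ⊤ from hX]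
      exact Submodule.mem_top
    obtain ⟨η, hη, hd⟩ := Metric.mem_closure_iff.1 hmem (ε / 3) (by positivity)
    have hη' : Tendsto (fun e => X.Φ e η) (CStarAlgebra.approximateUnit A) (𝓝 η) := by
      clear hd
      induction hη using Submodule.span_induction with
      | mem ζ hζ =>
        obtain ⟨a, ξ', rfl⟩ := hζ
        have h1 := ((X.orbit ξ').continuous.tendsto _).comp (hl.tendsto_mul_right a)
        refine h1.congr fun e => ?_
        change X.Φ (e * a) ξ' = _
        rw [map_mul]
        rfl
      | zero => simp
      | add ζ ζ' _ _ h1 h2 => simpa only [map_add] using h1.add h2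
      | smul c ζ _ h1 => simpa only [map_smul] using h1.const_smul c
    filter_upwards [Metric.tendsto_nhds.1 hη' (ε / 3) (by positivity), hl.eventually_norm]
      with e h1 hn
    have h2 : dist (X.Φ e ξ) (X.Φ e η) ≤ dist ξ η := by
      rw [dist_eq_norm, dist_eq_norm, ← map_sub]
      exact (X.norm_Φ_le e _).trans (mul_le_of_le_one_left (norm_nonneg _) hn)
    rw [dist_comm ξ η] at hd h2
    linarith [dist_triangle4 (X.Φ e ξ) (X.Φ e η) η ξ]
  have hpos : ∀ e : A, 0 ≤ e → ∀ ξ : E, 0 ≤ τ (ip A ξ (X.Φ e ξ)) := fun e h0 ξ => by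
    obtain ⟨b, rfl⟩ := CStarAlgebra.nonneg_iff_eq_star_mul_self.1 h0
    refine (mono_of_positive hτ.1.nonneg (ip_self_nonneg (A := A) (X.Φ b ξ))).trans_eq' ?_
      |>.trans_eq ?_
    · simp
    · rw [X.adjoint, map_mul]; rfl
  have hle : ∀ F : Finset Λ,
      (∑ ξ ∈ F, (Real.exp (-β) : ℂ) * τ (ip A (ξ : E) (ξ : E))).re ≤ ‖τ‖ := fun F => by
    have h1 : Tendsto (fun e => (∑ ξ ∈ F, (Real.exp (-β) : ℂ) *
        τ (ip A (ξ : E) (X.Φ e (ξ : E)))).re) (CStarAlgebra.approximateUnit A)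
        (𝓝 (∑ ξ ∈ F, (Real.exp (-β) : ℂ) * τ (ip A (ξ : E) (ξ : E))).re) := by
      refine (Complex.continuous_re.tendsto _).comp (tendsto_finsetSum _ fun ξ _ => ?_)
      refine ((τ.continuous.tendsto _).comp ?_).const_mul _
      exact ((ipL A (ξ : E)).continuous.tendsto _).comp (hξ _)
    refine le_of_tendsto h1 ?_
    filter_upwards [hl.eventually_nonneg, hl.eventually_norm] with e h0 hn
    have h2 := sum_le_hasSum F (fun ξ _ => mul_nonneg he (hpos e h0 (ξ : E))) (hτ.2.2 e)
    refine ((RCLike.le_iff_re_im.1 h2).1.trans (Complex.re_le_norm _)).trans ?_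
    exact (τ.le_opNorm e).trans (mul_le_of_le_one_right (norm_nonneg _) hn)
  have h1 := (Complex.continuous_re.tendsto _).comp hτ.2.1
  exact le_of_tendsto h1 (.of_forall hle)

end Extension

end

end CuntzToeplitz


theorem mainTheorem2 {A E : Type*} [NonUnitalCStarAlgebra A] [PartialOrder A] [StarOrderedRing A]
    [NormedAddCommGroup E] [NormedSpace ℂ E] [CompleteSpace E] [SMul Aᵐᵒᵖ E] [CStarModule Aᵐᵒᵖ E]
    (X : CuntzToeplitz.Correspondence A E)
    (Λ : Set E) (hΛ : CuntzToeplitz.IsFrame A Λ) (β : ℝ) (hβ : β ≠ 0) :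
    Convex ℝ (CuntzToeplitz.infiniteKMS X Λ β) ∧
    Convex ℝ (CuntzToeplitz.scalingTraces X Λ β) ∧
    Set.BijOn (CuntzToeplitz.restriction X)
      (CuntzToeplitz.infiniteKMS X Λ β) (CuntzToeplitz.scalingTraces X Λ β) ∧
    (∀ ω₁ ∈ CuntzToeplitz.infiniteKMS X Λ β, ∀ ω₂ ∈ CuntzToeplitz.infiniteKMS X Λ β,
      ∀ s t : ℝ, 0 ≤ s → 0 ≤ t → s + t = 1 →
        CuntzToeplitz.restriction X (s • ω₁ + t • ω₂) =
          s • CuntzToeplitz.restriction X ω₁ + t • CuntzToeplitz.restriction X ω₂) ∧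
    (X.Nondegenerate → ∀ τ ∈ CuntzToeplitz.scalingTraces X Λ β, CuntzToeplitz.IsState τ) :=
  ⟨CuntzToeplitz.convex_infiniteKMS hΛ, CuntzToeplitz.convex_scalingTraces,
    ⟨fun _ h => CuntzToeplitz.restriction_mem hΛ h, CuntzToeplitz.injOn_restriction hΛ hβ,
      CuntzToeplitz.surjOn_restriction hΛ⟩,
    fun _ _ _ _ _ _ _ _ _ => rfl,
    fun hX _ hτ => CuntzToeplitz.isState_of_nondegenerate hΛ hX hτ⟩
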